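/- **Setting.** Let $\mathcal P=\{\xi\in\mathbb R^3:\xi_3=\xi_1^2+\xi_2^2\le 1\}$ and $L\ge 2$. Let $(\theta_j)_j$ be a family of caps $\theta_j=\mathcal P\cap \overline B(c_j,L^{-1})$ with centers $c_j\in\mathcal P$ that cover $\mathcal P$ and are finitely overlapping: no point lies in more than $M$ of them. For each $j$ let $\mathbb T_j$ be a family of parallel $1\times L$ tubes (rectangular boxes of side lengths $1,1,L$ whose long side points in the direction normal to $\mathcal P$ at $c_j$) that tile $\mathbb R^3$, that is, they cover $\mathbb R^3$ and have pairwise disjoint interiors. For $\Omega\subset\mathbb R^3$ put $$N=\#\{j:\text{ some tube of }\mathbb T_j\text{ lies in }\Omega\cap \overline B(0,5L)\}.$$ **Theorem 4.1.** Let $1\le\alpha\le3$, and let $C$ and $M$ be constants. There is a constant $K>0$, depending only on $\alpha$, $C$ and $M$, such that for every $L\ge2$, all caps $\theta_j$ and tilings $\mathbb T_j$ as above, and every set $\Omega\subset\mathbb R^3$ with $$|\Omega\cap B_R|\le C R^\alpha\quad\text{for all balls }B_R\subset\mathbb R^3\text{ of radius }R\ge1$$ (where $|\cdot|$ is Lebesgue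 measure), the number $N$ is finite and $$N\le K(\log L)\,L^{\alpha-1}\ \text{ if }1\le\alpha\le2,\qquad N\le K(\log L)\,L^{2\alpha-3}\ \text{ if }2\le\alpha\le3.$$ -/

import Mathlib

open MeasureTheory

/-- Euclidean three-space. -/
abbrev R3 : Type := EuclideanSpace ℝ (Fin 3)

/-- The unit paraboloid `ξ₃ = ξ₁² + ξ₂² ≤ 1` in three-space. -/
def paraboloid : Set R3 :=
  {ξ | ξ 2 = ξ 0 ^ 2 + ξ 1 ^ 2 ∧ ξ 0 ^ 2 + ξ 1 ^ 2 ≤ 1}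

/-- The cap of the paraboloid with center `c` and radius `r`. -/
def paraboloidCap (c : R3) (r : ℝ) : Set R3 :=
  paraboloid ∩ Metric.closedBall c r

/-- A unit vector normal to the paraboloid at its point `c`: the gradient of
`ξ₁² + ξ₂² - ξ₃`, normalized. -/
noncomputable def unitNormal (c : R3) : R3 :=
  (Real.sqrt (4 * c 0 ^ 2 + 4 * c 1 ^ 2 + 1))⁻¹ • !₂[2 * c 0, 2 * c 1, -1]

/-- The points `c j` of the paraboloid are the centers of caps of radius `L⁻¹` that cover the
paraboloid, and no point lies in more than `M` of these caps. -/
structure IsCapDecomposition {ι : Type*} (L : ℝ) (M : ℕ) (c : ι → R3) : Prop where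
  center_mem : ∀ j, c j ∈ paraboloid
  cover : paraboloid ⊆ ⋃ j, paraboloidCap (c j) L⁻¹
  overlap : ∀ ξ : R3, {j | ξ ∈ paraboloidCap (c j) L⁻¹}.encard ≤ M

/-- `T` is a `1 × L` tube in the direction of the unit vector `v`: a (closed) rectangular box
with side lengths `1, 1, L` whose side of length `L` is parallel to `v`. -/
def IsTube (v : R3) (L : ℝ) (T : Set R3) : Prop :=
  ∃ p e₁ e₂ : R3, Orthonormal ℝ ![e₁, e₂, v] ∧
    T = {x | |inner ℝ e₁ (x - p)| ≤ 1 / 2 ∧ |inner ℝ e₂ (x - p)| ≤ 1 / 2 ∧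
      |inner ℝ v (x - p)| ≤ L / 2}

/-- `F` is a family of parallel `1 × L` tubes in the direction `v` that tile three-space. -/
structure IsTubeTiling (v : R3) (L : ℝ) (F : Set (Set R3)) : Prop where
  isTube : ∀ T ∈ F, IsTube v L T
  cover : ⋃₀ F = Set.univ
  disjoint : F.Pairwise fun T T' => Disjoint (interior T) (interior T')

/-- `|Ω ∩ B| ≤ C R ^ α` for every ball `B` of radius `R ≥ 1`. -/
def HasDimension (C α : ℝ) (Ω : Set R3) : Prop :=
  ∀ (x : R3) (R : ℝ), 1 ≤ R →
    volume (Ω ∩ Metric.closedBall x R) ≤ ENNReal.ofReal (C * R ^ α)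

/-- The set of indices `j` such that some tube of the family `F j` lies in `Ω ∩ B(0, 5L)`. -/
def tubeDirections {ι : Type*} (L : ℝ) (F : ι → Set (Set R3)) (Ω : Set R3) : Set ι :=
  {j | ∃ T ∈ F j, T ⊆ Ω ∩ Metric.closedBall 0 (5 * L)}

/-! Disjoint tubes would give `N * L ≲ L ^ α` by volume. The point is that tubes with separated
directions overlap on average at most `D * log L` times, up to a constant, where `D` controls the
mass of `Ω` in fat tubes: a tube of radius `r` and length about `L` holds at most `D * r * L` of it.
Cutting that tube into `L / r` balls of radius `r` gives `r ^ (α - 1) * L`, so `D = max 1 (L ^ (α -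
2))` works up to constants (`TubeConfig.fatBound_of_dimension`), and both exponents follow at once.

The overlap bound is `exists_card_tubes_le`, for tubes discretized over integer heights.
`exists_level` picks a multiplicity `m` such that points of multiplicity between `m` and `H`, a
constant times `m`, carry most of the incidences at points of multiplicity at least `m`. At each
such point `exists_concentrated_scale` finds the least scale `ρ` at which a fixed share of the
directions lies in one `ρ`-disc; at most half of them lie in any `64 ρ`-disc about one of them, so
many tubes are transversal to the concentrated ones. `dyadic_weak_type` discards tubes locally
dominated by points of multiplicity at least `H`.

Now count configurations: a tube `j`, two far apart points on it, and a tube `t` transversal to `j`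
at the second. Cauchy–Schwarz groups them by the first point `y` and `t`, weighted by the angle
between `t` and the central direction at `y`. For fixed `y`, the tube `t` spends about `n * ρ /
angle` heights in the fat tube of radius about `n * ρ` around the central tube at `y`, half of them
at points of multiplicity below `H`; the fat tube bound therefore controls the sum of `1 / angle`
(`sum_inv_angle_le`). For the other factor, a second tube `k` through `y` meeting `t` is nearly
coplanar with `j` and `t`. Its slope lies in a strip, where separation of directions leaves only a
logarithm (`sum_links_tail_le`). Together these give `mass_pow_le`, which bounds `m`. -/

section TubeCombinatorics

open scoped Classical

/-! ### Discretized tubes and their incidences -/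

/-- A finite system of discretized tubes in `ℂ × ℤ`: the tube `j` has slope `ω j`, lives over the
`2 ^ e` consecutive heights starting at `σ j`, and passes at height `s` through the cell `c j s`. -/
structure TubeConfig (ι : Type*) where
  J : Finset ι
  e : ℕ
  ω : ι → ℂ
  p : ι → ℂ
  σ : ι → ℤ
  c : ι → ℤ → ℂ
  norm_ω_le : ∀ j ∈ J, ‖ω j‖ ≤ 2
  near : ∀ j ∈ J, ∀ s ∈ Finset.Ico (σ j) (σ j + 2 ^ e), ‖c j s - (p j + s * ω j)‖ ≤ 1 / 4

namespace TubeConfig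

variable {ι : Type*} (S : TubeConfig ι)

/-- The number of heights of each tube. -/
def n : ℝ := 2 ^ S.e

/-- The heights over which a tube lives. -/
noncomputable def heights (j : ι) : Finset ℤ := Finset.Ico (S.σ j) (S.σ j + 2 ^ S.e)

/-- The point of the tube `j` at height `s`. -/
def pt (j : ι) (s : ℤ) : ℂ × ℤ := (S.c j s, s)

/-- The tubes through a point. -/
noncomputable def tubesAt (a : ℂ × ℤ) : Finset ι :=
  S.J.filter fun j => a.2 ∈ S.heights j ∧ S.c j a.2 = a.1

/-- All points on the tubes. -/
noncomputable def points : Finset (ℂ × ℤ) :=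
  S.J.biUnion fun j => (S.heights j).image (S.pt j)

/-- The number of tubes through a point. -/
noncomputable def mult (a : ℂ × ℤ) : ℕ := (S.tubesAt a).card

lemma n_pos : 0 < S.n := by unfold n; positivity

lemma one_le_n : 1 ≤ S.n := by unfold n; exact one_le_pow₀ (by norm_num)

lemma card_heights (j : ι) : (S.heights j).card = 2 ^ S.e := by
  simp only [heights, Int.card_Ico, add_sub_cancel_left]
  exact_mod_cast Int.toNat_natCast (2 ^ S.e)

lemma mem_tubesAt {a : ℂ × ℤ} {j : ι} :
    j ∈ S.tubesAt a ↔ j ∈ S.J ∧ a.2 ∈ S.heights j ∧ S.c j a.2 = a.1 := by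
  simp [tubesAt]

lemma mem_tubesAt_pt {j t : ι} {s : ℤ} :
    t ∈ S.tubesAt (S.pt j s) ↔ t ∈ S.J ∧ s ∈ S.heights t ∧ S.c t s = S.c j s := by
  rw [mem_tubesAt]; rfl

lemma pt_mem_points {j : ι} {s : ℤ} (hj : j ∈ S.J) (hs : s ∈ S.heights j) :
    S.pt j s ∈ S.points := by
  simp only [points, Finset.mem_biUnion, Finset.mem_image]
  exact ⟨j, hj, s, hs, rfl⟩

/-- Summation over incidences, by tubes or by points. -/
lemma sum_incidence {R : Type*} [AddCommMonoid R] (f : ι → ℂ × ℤ → R) :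
    ∑ j ∈ S.J, ∑ s ∈ S.heights j, f j (S.pt j s) =
      ∑ a ∈ S.points, ∑ j ∈ S.tubesAt a, f j a := by
  have h1 : ∀ a, ∑ j ∈ S.tubesAt a, f j a =
      ∑ j ∈ S.J, if a.2 ∈ S.heights j ∧ S.c j a.2 = a.1 then f j a else 0 := fun a => by
    rw [tubesAt, Finset.sum_filter]
  simp_rw [h1]
  rw [Finset.sum_comm]
  refine Finset.sum_congr rfl fun j hj => ?_
  rw [← Finset.sum_filter]
  symm
  refine Finset.sum_bij' (fun a _ => a.2) (fun s _ => S.pt j s) ?_ ?_ ?_ ?_ ?_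
  · intro a ha; simp only [Finset.mem_filter] at ha; exact ha.2.1
  · intro s hs; simp only [Finset.mem_filter]
    exact ⟨S.pt_mem_points hj hs, hs, rfl⟩
  · intro a ha; simp only [Finset.mem_filter] at ha; exact Prod.ext ha.2.2 rfl
  · intro s hs; rfl
  · intro a ha; simp only [Finset.mem_filter] at ha
    have : S.pt j a.2 = a := Prod.ext ha.2.2 rfl
    rw [this]

/-- Two tubes through the same cell at height `s` have nearby axes there. -/
lemma axis_close {j t : ι} {s : ℤ} (hj : j ∈ S.J) (ht : t ∈ S.J) (hs : s ∈ S.heights j)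
    (hs' : s ∈ S.heights t) (h : S.c j s = S.c t s) :
    ‖(S.p j - S.p t) + s * (S.ω j - S.ω t)‖ ≤ 1 / 2 := by
  have h1 := S.near j hj s hs
  have h2 := S.near t ht s hs'
  have : (S.p j - S.p t) + s * (S.ω j - S.ω t) =
      (S.c t s - (S.p t + s * S.ω t)) - (S.c j s - (S.p j + s * S.ω j)) := by rw [h]; ring
  rw [this]
  refine (norm_sub_le _ _).trans ?_
  linarith

lemma norm_sub_le_four {j t : ι} (hj : j ∈ S.J) (ht : t ∈ S.J) : ‖S.ω j - S.ω t‖ ≤ 4 := by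
  refine (norm_sub_le _ _).trans ?_
  have := S.norm_ω_le j hj
  have := S.norm_ω_le t ht
  linarith

/-- Directions are separated up to multiplicity `M`. -/
def DirSep (M : ℝ) : Prop := ∀ z : ℂ, ((S.J.filter fun j => ‖S.ω j - z‖ ≤ 1 / S.n).card : ℝ) ≤ M

/-- Fat tubes of radius `r` contain at most `D r n` points. -/
def FatBound (D : ℝ) : Prop := ∀ (z v : ℂ) (r : ℝ), ‖v‖ ≤ 2 → 1 ≤ r → r ≤ 4 * S.n →
  ((S.points.filter fun a => ‖a.1 - (z + a.2 * v)‖ ≤ 7 * r).card : ℝ) ≤ D * r * S.n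

end TubeConfig

/-! ### Packing, the dyadic maximal function and sums over separated vectors -/

/-- A finite set of complex numbers in a disc of radius `K ρ` has at most `(4 K + 1) ^ 2 B`
elements if each disc of radius `ρ` centred at one of them has at most `B`. -/
lemma card_le_of_local_card_le {ι : Type*} (s : Finset ι) (z : ι → ℂ) (z₀ : ℂ) {ρ B : ℝ} (K : ℕ)
    (hρ : 0 < ρ) (hB : 0 ≤ B) (hs : ∀ j ∈ s, ‖z j - z₀‖ ≤ K * ρ)
    (hloc : ∀ j ∈ s, ((s.filter fun j' => ‖z j' - z j‖ ≤ ρ).card : ℝ) ≤ B) :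
    (s.card : ℝ) ≤ (4 * K + 1) ^ 2 * B := by
  -- In cells of side `ρ / 2`, two vectors of one cell are within `ρ` even in the `ℓ¹` norm, and
  -- each coordinate takes at most `4 K + 1` values.
  set f : ι → ℤ × ℤ := fun j => (⌊(z j - z₀).re / (ρ / 2)⌋, ⌊(z j - z₀).im / (ρ / 2)⌋) with hf
  set T : Finset (ℤ × ℤ) := Finset.Icc (-(2 * K : ℤ)) (2 * K) ×ˢ Finset.Icc (-(2 * K : ℤ)) (2 * K)
    with hT
  have hbd : ∀ x : ℝ, |x| ≤ K * ρ → ⌊x / (ρ / 2)⌋ ∈ Finset.Icc (-(2 * K : ℤ)) (2 * K) := by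
    intro x hx
    rw [abs_le] at hx
    rw [Finset.mem_Icc]
    constructor
    · rw [Int.le_floor, le_div_iff₀ (by positivity)]; push_cast; nlinarith
    · have : x / (ρ / 2) < (2 * K : ℤ) + 1 := by
        rw [div_lt_iff₀ (by positivity)]; push_cast; nlinarith
      exact Int.lt_add_one_iff.mp (Int.floor_lt.mpr (by exact_mod_cast this))
  have hmaps : ∀ j ∈ s, f j ∈ T := by
    intro j hj
    have := hs j hj
    rw [hT, Finset.mem_product]
    exact ⟨hbd _ ((Complex.abs_re_le_norm _).trans this),
      hbd _ ((Complex.abs_im_le_norm _).trans this)⟩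
  have hclose : ∀ x y : ℝ, ⌊x / (ρ / 2)⌋ = ⌊y / (ρ / 2)⌋ → |x - y| ≤ ρ / 2 := by
    intro x y h
    have := Int.abs_sub_lt_one_of_floor_eq_floor h
    rw [← sub_div, abs_div, abs_of_pos (show 0 < ρ / 2 by positivity),
      div_lt_one (by positivity)] at this
    exact this.le
  have hfib : ∀ b ∈ T, ((s.filter fun j => f j = b).card : ℝ) ≤ B := by
    intro b _
    rcases (s.filter fun j => f j = b).eq_empty_or_nonempty with h | ⟨j, hj⟩
    · rw [h]; simpa using hB
    · rw [Finset.mem_filter] at hj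
      refine le_trans ?_ (hloc j hj.1)
      norm_cast
      refine Finset.card_le_card fun j' hj' => ?_
      rw [Finset.mem_filter] at hj' ⊢
      refine ⟨hj'.1, ?_⟩
      have he : f j' = f j := hj'.2.trans hj.2.symm
      simp only [hf, Prod.mk.injEq] at he
      have h1 := hclose _ _ he.1
      have h2 := hclose _ _ he.2
      have h3 := Complex.norm_le_abs_re_add_abs_im (z j' - z j)
      simp only [Complex.sub_re, Complex.sub_im] at h1 h2 h3
      rw [show (z j').re - z₀.re - ((z j).re - z₀.re) = (z j').re - (z j).re by ring] at h1
      rw [show (z j').im - z₀.im - ((z j).im - z₀.im) = (z j').im - (z j).im by ring] at h2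
      linarith
  have hcard : (T.card : ℝ) = (4 * K + 1) ^ 2 := by
    rw [hT, Finset.card_product, Int.card_Icc]
    have : (2 * (K : ℤ) + 1 - -(2 * K)).toNat = 4 * K + 1 := by omega
    rw [this]; push_cast; ring
  rw [← hcard, Finset.card_eq_sum_card_fiberwise hmaps]
  push_cast
  rw [← nsmul_eq_mul]
  exact Finset.sum_le_card_nsmul _ _ _ hfib

/-- The weak type bound for the dyadic maximal function on `{0, …, 2 ^ e - 1}`. -/
lemma dyadic_weak_type (e : ℕ) : ∀ P : ℕ → Prop,
    ((Finset.range (2 ^ e)).filter fun i => ∃ d ≤ e,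
      2 ^ d < 2 * ((Finset.range (2 ^ e)).filter fun i' => P i' ∧ i' / 2 ^ d = i / 2 ^ d).card).card
      ≤ 2 * ((Finset.range (2 ^ e)).filter P).card := by
  induction e with
  | zero =>
    intro P
    by_cases h : P 0
    · simp [h, Finset.filter_singleton]
    · simp [h, Finset.filter_singleton]
  | succ e ih =>
    intro P
    -- If the whole range is heavy the bound is trivial. Otherwise every heavy block lies in one
    -- half, and the induction hypothesis applies to both halves.
    by_cases hbig : 2 ^ (e + 1) < 2 * ((Finset.range (2 ^ (e + 1))).filter P).card
    · refine le_trans (Finset.card_filter_le _ _) ?_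
      rw [Finset.card_range]; exact hbig.le
    have hsplit : ∀ (R : ℕ → Prop) [DecidablePred R], ((Finset.range (2 ^ (e + 1))).filter R).card =
        ((Finset.range (2 ^ e)).filter R).card +
          ((Finset.range (2 ^ e)).filter fun i => R (2 ^ e + i)).card := by
      intro R _
      rw [pow_succ, mul_two]
      simp only [Finset.card_filter, Finset.sum_range_add]
    have hdiv : ∀ d ≤ e, ∀ i, (2 ^ e + i) / 2 ^ d = 2 ^ (e - d) + i / 2 ^ d := by
      intro d hd i
      have : (2 : ℕ) ^ e = 2 ^ d * 2 ^ (e - d) := by rw [← pow_add]; congr 1; omega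
      rw [this, Nat.mul_add_div (by positivity)]
    have hlt : ∀ d ≤ e, ∀ i < 2 ^ e, i / 2 ^ d < 2 ^ (e - d) := by
      intro d hd i hi
      rw [Nat.div_lt_iff_lt_mul (by positivity), ← pow_add]
      rwa [show e - d + d = e by omega]
    have htop : ∀ d, d ≤ e + 1 → ∀ i < 2 ^ (e + 1), 2 ^ d < 2 * ((Finset.range (2 ^ (e + 1))).filter
        fun i' => P i' ∧ i' / 2 ^ d = i / 2 ^ d).card → d ≤ e := by
      intro d hd i _ h
      by_contra hde
      have : d = e + 1 := by omega
      subst this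
      refine hbig (lt_of_lt_of_le h ?_)
      refine Nat.mul_le_mul_left _ (Finset.card_le_card fun i' hi' => ?_)
      rw [Finset.mem_filter] at hi' ⊢
      exact ⟨hi'.1, hi'.2.1⟩
    rw [hsplit P, mul_add, hsplit fun i => ∃ d ≤ e + 1, 2 ^ d < 2 * ((Finset.range
      (2 ^ (e + 1))).filter fun i' => P i' ∧ i' / 2 ^ d = i / 2 ^ d).card]
    refine add_le_add (le_trans ?_ (ih P)) (le_trans ?_ (ih fun i => P (2 ^ e + i)))
    · refine Finset.card_le_card fun i hi => ?_
      rw [Finset.mem_filter, Finset.mem_range] at hi ⊢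
      obtain ⟨hi, d, hd, hlt'⟩ := hi
      have hde := htop d hd i (hi.trans (by rw [pow_succ]; have := Nat.two_pow_pos e; omega)) hlt'
      refine ⟨hi, d, hde, lt_of_lt_of_eq hlt' ?_⟩
      rw [hsplit, Nat.add_eq_left.mpr]
      rw [Finset.card_eq_zero, Finset.filter_eq_empty_iff]
      rintro i' _ ⟨_, h⟩
      rw [hdiv d hde] at h
      exact absurd (h ▸ hlt d hde i hi) (by simp)
    · refine Finset.card_le_card fun i hi => ?_
      rw [Finset.mem_filter, Finset.mem_range] at hi ⊢
      obtain ⟨hi, d, hd, hlt'⟩ := hi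
      have hde := htop d hd _ (by rw [pow_succ]; omega) hlt'
      refine ⟨hi, d, hde, lt_of_lt_of_eq hlt' ?_⟩
      rw [hsplit, Nat.add_eq_right.mpr]
      · congr 2
        refine Finset.filter_congr fun i' _ => ?_
        rw [hdiv d hde, hdiv d hde, Nat.add_left_cancel_iff]
      · rw [Finset.card_eq_zero, Finset.filter_eq_empty_iff]
        rintro i' hi' ⟨_, h⟩
        rw [hdiv d hde] at h
        exact absurd (h ▸ hlt d hde i' (Finset.mem_range.mp hi')) (by simp)

/-- A finite set of integers of diameter at most `R` has at most `R + 1` elements. -/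
lemma Int.card_le_of_diam_le (A : Finset ℤ) {R : ℝ} (hR : 0 ≤ R)
    (h : ∀ a ∈ A, ∀ b ∈ A, (b : ℝ) - a ≤ R) : (A.card : ℝ) ≤ R + 1 := by
  rcases A.eq_empty_or_nonempty with rfl | hA
  · simp; linarith
  · have h1 : A ⊆ Finset.Icc (A.min' hA) (A.max' hA) := fun x hx =>
      Finset.mem_Icc.mpr ⟨A.min'_le x hx, A.le_max' x hx⟩
    have h2 := Finset.card_le_card h1
    rw [Int.card_Icc] at h2
    have h3 := h _ (A.min'_mem hA) _ (A.max'_mem hA)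
    have h4 : A.min' hA ≤ A.max' hA := A.min'_le _ (A.max'_mem hA)
    have h5 : (A.card : ℤ) ≤ A.max' hA + 1 - A.min' hA := by omega
    have h6 : (A.card : ℝ) ≤ A.max' hA + 1 - A.min' hA := by exact_mod_cast h5
    linarith

lemma sum_inv_range_two_pow_le (m : ℕ) :
    ∑ k ∈ Finset.range (2 ^ m), (1 : ℝ) / (k + 1) ≤ m + 1 := by
  induction m with
  | zero => simp
  | succ m ih =>
    rw [pow_succ, mul_two, Finset.sum_range_add]
    have : ∑ x ∈ Finset.range (2 ^ m), (1 : ℝ) / (((2 ^ m + x : ℕ) : ℝ) + 1) ≤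
        ∑ x ∈ Finset.range (2 ^ m), (1 : ℝ) / 2 ^ m := by
      refine Finset.sum_le_sum fun x _ => ?_
      refine one_div_le_one_div_of_le (by positivity) ?_
      push_cast
      have : (0 : ℝ) ≤ x := by positivity
      linarith
    rw [Finset.sum_const, Finset.card_range, nsmul_eq_mul] at this
    push_cast at this ⊢
    rw [mul_one_div_cancel (by positivity)] at this
    linarith

lemma sum_inv_one_add_abs_le (m : ℕ) :
    ∑ a ∈ Finset.Ioo (-(2 ^ m : ℤ)) (2 ^ m), (1 : ℝ) / (1 + |(a : ℝ)|) ≤ 2 * (m + 1) := by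
  have hsub : Finset.Ioo (-(2 ^ m : ℤ)) (2 ^ m) ⊆
      (Finset.range (2 ^ m)).image (fun k : ℕ => (k : ℤ)) ∪
        (Finset.range (2 ^ m)).image (fun k : ℕ => -(k : ℤ)) := by
    intro a ha
    rw [Finset.mem_Ioo] at ha
    simp only [Finset.mem_union, Finset.mem_image, Finset.mem_range]
    rcases le_total 0 a with h | h
    · refine Or.inl ⟨a.toNat, ?_, by omega⟩
      zify; rw [Int.toNat_of_nonneg h]; exact ha.2
    · refine Or.inr ⟨(-a).toNat, ?_, by omega⟩
      zify; rw [Int.toNat_of_nonneg (by omega)]; omega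
  have h0 : ∀ a : ℤ, (0 : ℝ) ≤ 1 / (1 + |(a : ℝ)|) := fun a => by positivity
  refine (Finset.sum_le_sum_of_subset_of_nonneg hsub fun a _ _ => h0 a).trans ?_
  refine (le_add_of_nonneg_right (Finset.sum_nonneg fun a _ => h0 a)).trans
    (Finset.sum_union_inter).le |>.trans ?_
  rw [Finset.sum_image (by simp), Finset.sum_image (by simp)]
  have := sum_inv_range_two_pow_le m
  have h1 : ∀ k : ℕ, (1 : ℝ) / (1 + |((k : ℤ) : ℝ)|) = 1 / (k + 1) := fun k => by
    rw [Int.cast_natCast, abs_of_nonneg (by positivity), add_comm]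
  have h2 : ∀ k : ℕ, (1 : ℝ) / (1 + |((-(k : ℤ) : ℤ) : ℝ)|) = 1 / (k + 1) := fun k => by
    rw [Int.cast_neg, abs_neg, Int.cast_natCast, abs_of_nonneg (by positivity), add_comm]
  simp only [h1, h2]
  linarith

/-- The sum of `1 / (1 + n ‖v‖)` over separated vectors `v` in a strip. -/
lemma sum_inv_strip_le {ι : Type*} (s : Finset ι) (v : ι → ℂ) (w : ℂ) (e : ℕ) {δ B : ℝ}
    (hw : w ≠ 0) (hδ : 0 ≤ δ) (hB : 0 ≤ B) (hv : ∀ i ∈ s, ‖v i‖ ≤ 4)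
    (hstrip : ∀ i ∈ s, ∃ t : ℝ, ‖v i - t * w‖ ≤ δ)
    (hsep : ∀ z : ℂ, ((s.filter fun i => ‖v i - z‖ ≤ 1 / 2 ^ e).card : ℝ) ≤ B) :
    ∑ i ∈ s, 1 / (1 + 2 ^ e * ‖v i‖) ≤ 20 * B * (4 * (2 ^ e * δ) + 2) * (e + 1) := by
  set n : ℝ := 2 ^ e with hn
  have hn1 : 1 ≤ n := one_le_pow₀ (by norm_num)
  -- Multiplication by `u` rotates `w` to the positive real axis, so the strip becomes a bound on
  -- imaginary parts.
  set u : ℂ := (starRingEnd ℂ w) / ‖w‖ with hu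
  have hw' : (0 : ℝ) < ‖w‖ := norm_pos_iff.mpr hw
  have hun : ‖u‖ = 1 := by
    rw [hu, norm_div, Complex.norm_conj, Complex.norm_real, norm_norm, div_self hw'.ne']
  have hwu : w * u = (‖w‖ : ℂ) := by
    rw [hu, mul_div_assoc', Complex.mul_conj', sq, mul_self_div_self]
  have hnorm : ∀ z : ℂ, ‖z * u‖ = ‖z‖ := fun z => by rw [norm_mul, hun, mul_one]
  have him : ∀ i ∈ s, |(v i * u).im| ≤ δ := by
    intro i hi
    obtain ⟨t, ht⟩ := hstrip i hi
    have h1 : ((v i - t * w) * u).im = (v i * u).im := by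
      rw [sub_mul, mul_assoc, hwu, ← Complex.ofReal_mul, Complex.sub_im, Complex.ofReal_im,
        sub_zero]
    rw [← h1]
    exact (Complex.abs_im_le_norm _).trans ((hnorm _).le.trans ht)
  -- Cells of side `1 / (2 n)` hold at most `B` vectors each. Along the strip the summand decays
  -- like the inverse of the column index, so the columns give a harmonic sum and the rows a factor
  -- of the width.
  set f : ι → ℤ × ℤ := fun i => (⌊2 * n * (v i * u).re⌋, ⌊2 * n * (v i * u).im⌋) with hf
  set T1 : Finset ℤ := Finset.Ioo (-(2 ^ (e + 4) : ℤ)) (2 ^ (e + 4)) with hT1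
  set T2 : Finset ℤ := Finset.Icc ⌊-(2 * n * δ)⌋ ⌊2 * n * δ⌋ with hT2
  have hmaps : ∀ i ∈ s, f i ∈ T1 ×ˢ T2 := by
    intro i hi
    have h1 := abs_le.mp (((Complex.abs_re_le_norm _).trans (hnorm (v i)).le).trans (hv i hi))
    have h2 := abs_le.mp (him i hi)
    rw [Finset.mem_product, hT1, hT2, Finset.mem_Ioo, Finset.mem_Icc]
    have hpow : ((2 ^ (e + 4) : ℤ) : ℝ) = 16 * n := by push_cast; rw [pow_add]; norm_num; ring
    refine ⟨⟨?_, ?_⟩, ?_, ?_⟩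
    · rw [← Int.add_one_le_iff, Int.le_floor, Int.cast_add, Int.cast_neg, hpow]
      push_cast; nlinarith
    · rw [Int.floor_lt, hpow]; nlinarith
    · exact Int.floor_le_floor (by nlinarith)
    · exact Int.floor_le_floor (by nlinarith)
  have hfib : ∀ b : ℤ × ℤ, ((s.filter fun i => f i = b).card : ℝ) ≤ B := by
    intro b
    rcases (s.filter fun i => f i = b).eq_empty_or_nonempty with h | ⟨j, hj⟩
    · rw [h]; simpa using hB
    · rw [Finset.mem_filter] at hj
      refine le_trans ?_ (hsep (v j))
      norm_cast
      refine Finset.card_le_card fun i hi => ?_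
      rw [Finset.mem_filter] at hi ⊢
      refine ⟨hi.1, ?_⟩
      have he : f i = f j := hi.2.trans hj.2.symm
      simp only [hf, Prod.mk.injEq] at he
      have h1 := (Int.abs_sub_lt_one_of_floor_eq_floor he.1).le
      have h2 := (Int.abs_sub_lt_one_of_floor_eq_floor he.2).le
      rw [← mul_sub, abs_mul, abs_of_pos (show 0 < 2 * n by positivity), ← Complex.sub_re,
        ← sub_mul] at h1
      rw [← mul_sub, abs_mul, abs_of_pos (show 0 < 2 * n by positivity), ← Complex.sub_im,
        ← sub_mul] at h2
      have h3 := Complex.norm_le_abs_re_add_abs_im ((v i - v j) * u)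
      rw [hnorm] at h3
      rw [le_div_iff₀ (by positivity)]
      nlinarith
  have hterm : ∀ i ∈ s, 1 / (1 + n * ‖v i‖) ≤ 2 * (1 / (1 + |((f i).1 : ℝ)|)) := by
    intro i _
    rw [← hnorm (v i), mul_one_div, div_le_div_iff₀ (by positivity) (by positivity)]
    have h1 := Complex.abs_re_le_norm (v i * u)
    have h2 : |((f i).1 : ℝ)| ≤ 2 * n * |(v i * u).re| + 1 := by
      have h3 := Int.floor_le (2 * n * (v i * u).re)
      have h4 := Int.lt_floor_add_one (2 * n * (v i * u).re)
      have h5 := neg_abs_le (v i * u).re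
      have h6 := le_abs_self (v i * u).re
      simp only [hf]
      rw [abs_le]
      constructor <;> nlinarith
    nlinarith
  have hT2c : (T2.card : ℝ) ≤ 4 * (n * δ) + 2 := by
    have h0 : 0 ≤ n * δ := by positivity
    have h1 : ⌊-(2 * n * δ)⌋ ≤ ⌊2 * n * δ⌋ := Int.floor_le_floor (by linarith)
    have h2 : (T2.card : ℤ) = ⌊2 * n * δ⌋ + 1 - ⌊-(2 * n * δ)⌋ := by
      rw [hT2, Int.card_Icc, Int.toNat_of_nonneg (by omega)]
    have h3 : (T2.card : ℝ) = ⌊2 * n * δ⌋ + 1 - ⌊-(2 * n * δ)⌋ := by exact_mod_cast h2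
    have h4 := Int.floor_le (2 * n * δ)
    have h5 := Int.lt_floor_add_one (-(2 * n * δ))
    linarith
  calc ∑ i ∈ s, 1 / (1 + n * ‖v i‖) ≤ ∑ i ∈ s, 2 * (1 / (1 + |((f i).1 : ℝ)|)) :=
        Finset.sum_le_sum hterm
    _ = ∑ b ∈ T1 ×ˢ T2, ∑ i ∈ s with f i = b, 2 * (1 / (1 + |((f i).1 : ℝ)|)) :=
        (Finset.sum_fiberwise_of_maps_to hmaps _).symm
    _ ≤ ∑ b ∈ T1 ×ˢ T2, B * (2 * (1 / (1 + |(b.1 : ℝ)|))) := by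
        refine Finset.sum_le_sum fun b _ => ?_
        rw [Finset.sum_congr rfl (g := fun _ => 2 * (1 / (1 + |(b.1 : ℝ)|)))
          (fun i hi => by rw [(Finset.mem_filter.mp hi).2]), Finset.sum_const, nsmul_eq_mul]
        exact mul_le_mul_of_nonneg_right (hfib b) (by positivity)
    _ = B * (2 * (T2.card * ∑ a ∈ T1, 1 / (1 + |(a : ℝ)|))) := by
        rw [Finset.sum_product, Finset.mul_sum, Finset.mul_sum, Finset.mul_sum]
        refine Finset.sum_congr rfl fun a _ => ?_
        simp only [Finset.sum_const, nsmul_eq_mul]; ring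
    _ ≤ B * (2 * ((4 * (n * δ) + 2) * (2 * ((e + 4 : ℕ) + 1)))) := by
        have := sum_inv_one_add_abs_le (e + 4)
        have h0 : (0 : ℝ) ≤ ∑ a ∈ T1, 1 / (1 + |(a : ℝ)|) :=
          Finset.sum_nonneg fun a _ => by positivity
        gcongr
    _ ≤ 20 * B * (4 * (n * δ) + 2) * (e + 1) := by
        have h0 : 0 ≤ B * (4 * (n * δ) + 2) := by positivity
        have h1 : (0 : ℝ) ≤ e := by positivity
        push_cast
        nlinarith [mul_nonneg h0 h1]

/-- A finite set of vectors in the disc has a smallest scale at which a definite proportion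
concentrates in one disc. -/
lemma exists_concentrated_scale {ι : Type*} (s : Finset ι) (z : ι → ℂ) (e : ℕ) (hs : s.Nonempty)
    (hz : ∀ i ∈ s, ∀ j ∈ s, ‖z i - z j‖ ≤ 4) :
    ∃ l ≤ e + 2, ∃ j ∈ s,
      s.card ≤ 526338 * (s.filter fun i => ‖z i - z j‖ ≤ 2 ^ l / 2 ^ e).card ∧
      (1 ≤ l → ∀ i ∈ s, 2 * (s.filter fun i' => ‖z i' - z i‖ ≤ 64 * (2 ^ l / 2 ^ e)).card
        ≤ s.card) := by
  -- The constant is `2 * 513 ^ 2` with `513 = 4 * 128 + 1`. A disc of radius `64 * 2 ^ l / 2 ^ e`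
  -- is 128 times larger than one at scale `l - 1`, where minimality of `l` forbids concentration.
  set P : ℕ → Prop := fun l => ∃ j ∈ s,
      s.card ≤ 526338 * (s.filter fun i => ‖z i - z j‖ ≤ 2 ^ l / 2 ^ e).card with hP
  have hPe : P (e + 2) := by
    obtain ⟨j, hj⟩ := hs
    refine ⟨j, hj, ?_⟩
    rw [Finset.filter_true_of_mem]
    · omega
    · intro i hi
      rw [pow_add, mul_div_cancel_left₀ _ (by positivity)]
      norm_num
      exact hz i hi j hj
  have hex : ∃ l, P l := ⟨_, hPe⟩
  refine ⟨Nat.find hex, Nat.find_min' hex hPe, ?_⟩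
  obtain ⟨j, hj, hcard⟩ := Nat.find_spec hex
  refine ⟨j, hj, hcard, fun hl i hi => ?_⟩
  set l := Nat.find hex with hldef
  have hnot : ¬ P (l - 1) := Nat.find_min hex (by omega)
  simp only [hP, not_exists, not_and, not_le] at hnot
  have hpow : (2 : ℝ) ^ l = 2 * 2 ^ (l - 1) := by
    rw [← pow_succ', Nat.sub_add_cancel hl]
  have key := card_le_of_local_card_le (s.filter fun i' => ‖z i' - z i‖ ≤ 64 * (2 ^ l / 2 ^ e))
    z (z i) (ρ := 2 ^ (l - 1) / 2 ^ e) (B := s.card / 526338) 128 (by positivity) (by positivity)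
    (fun i' hi' => by
      refine (Finset.mem_filter.mp hi').2.trans (le_of_eq ?_)
      rw [hpow]; push_cast; ring)
    (fun i' hi' => by
      rw [Finset.mem_filter] at hi'
      rw [le_div_iff₀ (by norm_num)]
      have h1 := (hnot i' hi'.1).le
      have h2 : ((s.filter fun i' => ‖z i' - z i‖ ≤ 64 * (2 ^ l / 2 ^ e)).filter
          fun j' => ‖z j' - z i'‖ ≤ 2 ^ (l - 1) / 2 ^ e).card ≤
          (s.filter fun j' => ‖z j' - z i'‖ ≤ 2 ^ (l - 1) / 2 ^ e).card :=
        Finset.card_le_card (Finset.filter_subset_filter _ (Finset.filter_subset _ _))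
      have h3 := (Nat.mul_le_mul_left 526338 h2).trans h1
      rw [mul_comm]
      exact_mod_cast h3)
  have : (2 : ℝ) * (s.filter fun i' => ‖z i' - z i‖ ≤ 64 * (2 ^ l / 2 ^ e)).card ≤ s.card := by
    refine (mul_le_mul_of_nonneg_left key (by norm_num)).trans (le_of_eq ?_)
    push_cast; ring
  exact_mod_cast this

/-! ### Intersections of two tubes and bad positions on a tube -/

namespace TubeConfig

variable {ι : Type*} (S : TubeConfig ι)

/-- Heights at which two tubes meet. -/
noncomputable def meet (j t : ι) : Finset ℤ :=
  (S.heights j).filter fun s => s ∈ S.heights t ∧ S.c j s = S.c t s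

/-- The axes separate at speed `‖S.ω j - S.ω t‖` but are within `1 / 2` at every meeting height, so
these heights span at most the inverse of that speed. -/
lemma card_meet_le {j t : ι} (hj : j ∈ S.J) (ht : t ∈ S.J) (h : S.ω j ≠ S.ω t) :
    ((S.meet j t).card : ℝ) ≤ 1 / ‖S.ω j - S.ω t‖ + 1 := by
  have hpos : 0 < ‖S.ω j - S.ω t‖ := norm_pos_iff.mpr (sub_ne_zero.mpr h)
  refine Int.card_le_of_diam_le _ (by positivity) fun a ha b hb => ?_
  rw [meet, Finset.mem_filter] at ha hb
  have h1 := S.axis_close hj ht ha.1 ha.2.1 ha.2.2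
  have h2 := S.axis_close hj ht hb.1 hb.2.1 hb.2.2
  have h3 : (((b : ℝ) - a : ℝ) : ℂ) * (S.ω j - S.ω t) =
      ((S.p j - S.p t) + b * (S.ω j - S.ω t)) - ((S.p j - S.p t) + a * (S.ω j - S.ω t)) := by
    push_cast; ring
  have h4 : |(b : ℝ) - a| * ‖S.ω j - S.ω t‖ ≤ 1 := by
    rw [← Real.norm_eq_abs, ← Complex.norm_real, ← norm_mul, h3]
    exact (norm_sub_le _ _).trans (by linarith)
  rw [le_div_iff₀ hpos]
  exact le_trans (mul_le_mul_of_nonneg_right (le_abs_self _) hpos.le) h4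

/-- For nearly parallel tubes the trivial bound by the length takes over; this form covers both
cases. -/
lemma card_meet_le' {j t : ι} (hj : j ∈ S.J) (ht : t ∈ S.J) :
    ((S.meet j t).card : ℝ) ≤ 10 * S.n * (1 / (1 + S.n * ‖S.ω j - S.ω t‖)) := by
  have hn := S.one_le_n
  set x := ‖S.ω j - S.ω t‖ with hx
  have hx0 : 0 ≤ x := norm_nonneg _
  rw [mul_one_div, le_div_iff₀ (by positivity)]
  by_cases h : S.n * x ≤ 1
  · have h1 : ((S.meet j t).card : ℝ) ≤ S.n := by
      have : (S.meet j t).card ≤ 2 ^ S.e := by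
        rw [← S.card_heights j]; exact Finset.card_filter_le _ _
      unfold n; exact_mod_cast this
    have h2 : (0 : ℝ) ≤ (S.meet j t).card := by positivity
    nlinarith
  · push Not at h
    have hxpos : 0 < x := by
      rcases hx0.eq_or_lt with h0 | h0
      · rw [← h0] at h; linarith
      · exact h0
    have hne : S.ω j ≠ S.ω t := fun h0 => by rw [hx, h0, sub_self, norm_zero] at hxpos; linarith
    have h1 := S.card_meet_le hj ht hne
    rw [← hx] at h1
    have h4 : x ≤ 4 := S.norm_sub_le_four hj ht
    have h2 : (1 / x + 1) * x ≤ 5 := by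
      rw [add_mul, one_div_mul_cancel hxpos.ne']; linarith
    have h3 : ((S.meet j t).card : ℝ) * x ≤ 5 :=
      (mul_le_mul_of_nonneg_right h1 hx0).trans h2
    have h5 : (0 : ℝ) ≤ (S.meet j t).card := by positivity
    nlinarith

/-- The position `s` on the tube `t` is bad for `hi` if some dyadic block of `t` around `s` has
more than half of its points in `hi`. -/
def Bad (hi : ℂ × ℤ → Prop) (t : ι) (s : ℤ) : Prop :=
  ∃ d ≤ S.e, 2 ^ d < 2 * ((Finset.range (2 ^ S.e)).filter fun i' : ℕ =>
    hi (S.pt t (S.σ t + i')) ∧ i' / 2 ^ d = (s - S.σ t).toNat / 2 ^ d).card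

lemma heights_eq_image (t : ι) :
    S.heights t = (Finset.range (2 ^ S.e)).image fun i : ℕ => S.σ t + i := by
  ext s
  simp only [heights, Finset.mem_Ico, Finset.mem_image, Finset.mem_range]
  constructor
  · rintro ⟨h1, h2⟩
    refine ⟨(s - S.σ t).toNat, ?_, by omega⟩
    zify; rw [Int.toNat_of_nonneg (by omega)]; linarith
  · rintro ⟨i, hi, rfl⟩
    have : (i : ℤ) < 2 ^ S.e := by exact_mod_cast hi
    constructor <;> linarith

lemma card_filter_heights (t : ι) (P : ℤ → Prop) [DecidablePred P] :
    ((S.heights t).filter P).card =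
      ((Finset.range (2 ^ S.e)).filter fun i : ℕ => P (S.σ t + i)).card := by
  rw [heights_eq_image, Finset.filter_image, Finset.card_image_of_injective]
  intro a b h
  simpa using h

lemma card_bad_le (hi : ℂ × ℤ → Prop) (t : ι) :
    ((S.heights t).filter fun s => S.Bad hi t s).card ≤
      2 * ((S.heights t).filter fun s => hi (S.pt t s)).card := by
  rw [card_filter_heights, card_filter_heights]
  convert dyadic_weak_type S.e fun i => hi (S.pt t (S.σ t + i)) using 6 with i
  simp [Bad]

/-- The dyadic block of length `2 ^ d` containing `s` stays within `2 ^ d` of `s`, and since `s` is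
not bad at most half of it lies in `hi`. -/
lemma card_good_ge (hi : ℂ × ℤ → Prop) {t : ι} {s : ℤ} (hs : s ∈ S.heights t)
    (hb : ¬ S.Bad hi t s) {d : ℕ} (hd : d ≤ S.e) :
    2 ^ d ≤ 2 * ((S.heights t).filter fun h : ℤ =>
      |(h : ℝ) - s| < 2 ^ d ∧ ¬ hi (S.pt t h)).card := by
  rw [card_filter_heights]
  have hb' : 2 * ((Finset.range (2 ^ S.e)).filter fun i' : ℕ => hi (S.pt t (S.σ t + i')) ∧
      i' / 2 ^ d = (s - S.σ t).toNat / 2 ^ d).card ≤ 2 ^ d := by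
    by_contra h
    exact hb ⟨d, hd, not_le.mp h⟩
  set i₀ := (s - S.σ t).toNat with hi₀
  have hs' : (S.σ t + i₀ : ℤ) = s ∧ i₀ < 2 ^ S.e := by
    rw [heights, Finset.mem_Ico] at hs
    refine ⟨by omega, ?_⟩
    zify; rw [hi₀, Int.toNat_of_nonneg (by omega)]; linarith
  have hblock : 2 ^ d ≤ ((Finset.range (2 ^ S.e)).filter fun i => i / 2 ^ d = i₀ / 2 ^ d).card := by
    have : (Finset.range (2 ^ d)).image (fun k => 2 ^ d * (i₀ / 2 ^ d) + k) ⊆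
        (Finset.range (2 ^ S.e)).filter fun i => i / 2 ^ d = i₀ / 2 ^ d := by
      intro i hi'
      simp only [Finset.mem_image, Finset.mem_range, Finset.mem_filter] at hi' ⊢
      obtain ⟨k, hk, rfl⟩ := hi'
      refine ⟨?_, ?_⟩
      · have h1 : i₀ / 2 ^ d < 2 ^ (S.e - d) := by
          rw [Nat.div_lt_iff_lt_mul (by positivity), ← pow_add, Nat.sub_add_cancel hd]
          exact hs'.2
        calc 2 ^ d * (i₀ / 2 ^ d) + k < 2 ^ d * (i₀ / 2 ^ d) + 2 ^ d := by omega
          _ = 2 ^ d * (i₀ / 2 ^ d + 1) := by ring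
          _ ≤ 2 ^ d * 2 ^ (S.e - d) := Nat.mul_le_mul_left _ h1
          _ = 2 ^ S.e := by rw [← pow_add]; congr 1; omega
      · rw [Nat.mul_add_div (by positivity), Nat.div_eq_of_lt hk, add_zero]
    have h2 := Finset.card_le_card this
    rwa [Finset.card_image_of_injective _ (fun a b h => by simpa using h), Finset.card_range] at h2
  have hsplit := Finset.card_filter_add_card_filter_not (s := (Finset.range (2 ^ S.e)).filter
    fun i => i / 2 ^ d = i₀ / 2 ^ d) (fun i : ℕ => hi (S.pt t (S.σ t + i)))
  rw [Finset.filter_filter, Finset.filter_filter] at hsplit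
  have hle : ((Finset.range (2 ^ S.e)).filter fun i : ℕ => i / 2 ^ d = i₀ / 2 ^ d ∧
      ¬ hi (S.pt t (S.σ t + i))).card ≤ ((Finset.range (2 ^ S.e)).filter fun i : ℕ =>
        |((S.σ t + i : ℤ) : ℝ) - s| < 2 ^ d ∧ ¬ hi (S.pt t (S.σ t + i))).card := by
    refine Finset.card_le_card fun i hi' => ?_
    rw [Finset.mem_filter] at hi' ⊢
    refine ⟨hi'.1, ?_, hi'.2.2⟩
    have h1 := Nat.div_add_mod i (2 ^ d)
    have h2 := Nat.div_add_mod i₀ (2 ^ d)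
    have h3 := Nat.mod_lt i (show 2 ^ d > 0 by positivity)
    have h4 := Nat.mod_lt i₀ (show 2 ^ d > 0 by positivity)
    rw [hi'.2.1] at h1
    rw [← hs'.1]
    push_cast
    rw [add_sub_add_left_eq_sub, abs_lt]
    have h5 : i < i₀ + 2 ^ d := by omega
    have h6 : i₀ < i + 2 ^ d := by omega
    have h5' : (i : ℝ) < i₀ + 2 ^ d := by exact_mod_cast h5
    have h6' : (i₀ : ℝ) < i + 2 ^ d := by exact_mod_cast h6
    constructor <;> linarith
  have hcomm : ((Finset.range (2 ^ S.e)).filter fun i : ℕ => i / 2 ^ d = i₀ / 2 ^ d ∧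
      hi (S.pt t (S.σ t + i))).card = ((Finset.range (2 ^ S.e)).filter fun i' : ℕ =>
        hi (S.pt t (S.σ t + i')) ∧ i' / 2 ^ d = i₀ / 2 ^ d).card := by
    congr 1
    exact Finset.filter_congr fun i _ => and_comm
  omega

end TubeConfig

/-! ### Concentrated directions and the lower bound for configurations -/

namespace TubeConfig

variable {ι : Type*} {S : TubeConfig ι}

/-- At each relevant point `a`, a set `κ a` of tubes with directions within `ρ a` of a central one,
to which many tubes through `a` are transversal and not bad. -/
structure Concentration (S : TubeConfig ι) (m H : ℕ) where
  κ : ℂ × ℤ → Finset ι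
  ρ : ℂ × ℤ → ℝ
  ctr : ℂ × ℤ → ι
  κ_sub : ∀ a, κ a ⊆ S.tubesAt a
  mult_bounds : ∀ a, (κ a).Nonempty → m ≤ S.mult a ∧ S.mult a < H
  ctr_mem : ∀ a, (κ a).Nonempty → ctr a ∈ S.tubesAt a
  κ_near : ∀ a, ∀ j ∈ κ a, ‖S.ω j - S.ω (ctr a)‖ ≤ ρ a
  two_le : ∀ a, (κ a).Nonempty → 2 ≤ S.n * ρ a
  ρ_le : ∀ a, (κ a).Nonempty → ρ a ≤ 4
  many : ∀ a, ∀ j ∈ κ a, m ≤ 4 * ((S.tubesAt a).filter fun t =>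
    64 * ρ a < ‖S.ω t - S.ω j‖ ∧ ¬ S.Bad (fun b => H ≤ S.mult b) t a.2).card

namespace Concentration

variable {m H : ℕ} (K : Concentration S m H)

/-- The tubes through `a` transversal to `j` and not bad. -/
noncomputable def transversal (a : ℂ × ℤ) (j : ι) : Finset ι :=
  (S.tubesAt a).filter fun t =>
    64 * K.ρ a < ‖S.ω t - S.ω j‖ ∧ ¬ S.Bad (fun b => H ≤ S.mult b) t a.2

/-- The relevant heights of a tube. -/
noncomputable def relevant (j : ι) : Finset ℤ := (S.heights j).filter fun s => j ∈ K.κ (S.pt j s)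

/-- The number of relevant incidences. -/
noncomputable def mass : ℝ := ∑ j ∈ S.J, ((K.relevant j).card : ℝ)

/-- Ordered pairs of relevant heights at distance at least `g`. -/
noncomputable def pairs (g : ℝ) (j : ι) : Finset (ℤ × ℤ) :=
  (K.relevant j ×ˢ K.relevant j).filter fun q =>
    K.ρ (S.pt j q.1) ≤ K.ρ (S.pt j q.2) ∧ g ≤ |(q.1 : ℝ) - q.2|

/-- Configurations: two points on a tube `j` and a transversal tube through the second. -/
noncomputable def configs (g : ℝ) : Finset (Σ _ : ι, Σ _ : ℤ × ℤ, ι) :=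
  S.J.sigma fun j => (K.pairs g j).sigma fun q => K.transversal (S.pt j q.2) j

lemma mem_relevant {j : ι} {s : ℤ} :
    s ∈ K.relevant j ↔ s ∈ S.heights j ∧ j ∈ K.κ (S.pt j s) := by
  rw [relevant, Finset.mem_filter]

lemma mem_configs {g : ℝ} {j t : ι} {s s' : ℤ} :
    (⟨j, (s, s'), t⟩ : Σ _ : ι, Σ _ : ℤ × ℤ, ι) ∈ K.configs g ↔
      j ∈ S.J ∧ s ∈ K.relevant j ∧ s' ∈ K.relevant j ∧
      K.ρ (S.pt j s) ≤ K.ρ (S.pt j s') ∧ g ≤ |(s : ℝ) - s'| ∧ t ∈ S.tubesAt (S.pt j s') ∧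
      64 * K.ρ (S.pt j s') < ‖S.ω t - S.ω j‖ ∧ ¬ S.Bad (fun b => H ≤ S.mult b) t s' := by
  rw [configs, Finset.mem_sigma, Finset.mem_sigma, pairs, Finset.mem_filter, Finset.mem_product,
    transversal, Finset.mem_filter]
  exact ⟨fun ⟨h1, ⟨⟨h2, h3⟩, h4, h5⟩, h6, h7, h8⟩ => ⟨h1, h2, h3, h4, h5, h6, h7, h8⟩,
    fun ⟨h1, h2, h3, h4, h5, h6, h7, h8⟩ => ⟨h1, ⟨⟨h2, h3⟩, h4, h5⟩, h6, h7, h8⟩⟩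

lemma mass_eq : K.mass = ∑ a ∈ S.points, ((K.κ a).card : ℝ) := by
  have h := S.sum_incidence fun j a => if j ∈ K.κ a then (1 : ℝ) else 0
  have h1 : ∀ j, ((K.relevant j).card : ℝ) =
      ∑ s ∈ S.heights j, if j ∈ K.κ (S.pt j s) then (1 : ℝ) else 0 := fun j => by
    rw [relevant, Finset.sum_boole]
  have h2 : ∀ a, ((K.κ a).card : ℝ) = ∑ j ∈ S.tubesAt a, if j ∈ K.κ a then (1 : ℝ) else 0 :=
    fun a => by
      rw [Finset.sum_boole, Finset.filter_mem_eq_inter, Finset.inter_eq_right.mpr (K.κ_sub a)]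
  simp only [mass, h1, h2]
  exact h

/-- By symmetry, at least half of the pairs at distance at least `g` are correctly ordered. -/
lemma two_mul_card_pairs_ge {g : ℝ} (hg : 1 / 2 ≤ g) (j : ι) :
    ((K.relevant j).card : ℝ) ^ 2 - 4 * g * (K.relevant j).card ≤ 2 * (K.pairs g j).card := by
  set R := K.relevant j with hR
  set Q := (R ×ˢ R).filter fun q => g ≤ |(q.1 : ℝ) - q.2| with hQ
  have h1 : Q.card ≤ (K.pairs g j).card + (K.pairs g j).card := by
    have hsub : Q ⊆ K.pairs g j ∪ (K.pairs g j).image Prod.swap := by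
      intro q hq
      rw [hQ, Finset.mem_filter, Finset.mem_product] at hq
      rw [Finset.mem_union]
      rcases le_total (K.ρ (S.pt j q.1)) (K.ρ (S.pt j q.2)) with h | h
      · left
        rw [pairs, Finset.mem_filter, Finset.mem_product]
        exact ⟨hq.1, h, hq.2⟩
      · right
        rw [Finset.mem_image]
        refine ⟨q.swap, ?_, Prod.swap_swap q⟩
        rw [pairs, Finset.mem_filter, Finset.mem_product]
        exact ⟨⟨hq.1.2, hq.1.1⟩, h, by rw [Prod.fst_swap, Prod.snd_swap, abs_sub_comm]; exact hq.2⟩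
    exact (Finset.card_le_card hsub).trans ((Finset.card_union_le _ _).trans
      (add_le_add_right Finset.card_image_le _))
  have h2 : (((R ×ˢ R).filter fun q => ¬ g ≤ |(q.1 : ℝ) - q.2|).card : ℝ) ≤ R.card * (4 * g) := by
    have : ((R ×ˢ R).filter fun q => ¬ g ≤ |(q.1 : ℝ) - q.2|).card =
        ∑ s ∈ R, (R.filter fun s' : ℤ => ¬ g ≤ |(s : ℝ) - s'|).card := by
      simp only [Finset.card_filter, Finset.sum_product]
    rw [this]
    push_cast
    rw [← nsmul_eq_mul]
    refine Finset.sum_le_card_nsmul _ _ _ fun s _ => ?_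
    -- The window contains at most `2 g + 1` integers, which is at most `4 g` because `1 / 2 ≤ g`.
    have := Int.card_le_of_diam_le (R.filter fun s' : ℤ => ¬ g ≤ |(s : ℝ) - s'|) (R := 2 * g)
      (by linarith) (fun a ha b hb => by
        have ha' := abs_lt.mp (not_le.mp (Finset.mem_filter.mp ha).2)
        have hb' := abs_lt.mp (not_le.mp (Finset.mem_filter.mp hb).2)
        linarith)
    linarith
  have h3 := Finset.card_filter_add_card_filter_not (s := R ×ˢ R)
    fun q : ℤ × ℤ => g ≤ |(q.1 : ℝ) - q.2|
  rw [Finset.card_product] at h3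
  change Q.card + _ = _ at h3
  have h3' : (Q.card : ℝ) + ((R ×ˢ R).filter fun q => ¬ g ≤ |(q.1 : ℝ) - q.2|).card =
      R.card * R.card := by exact_mod_cast h3
  have h1' : (Q.card : ℝ) ≤ (K.pairs g j).card + (K.pairs g j).card := by exact_mod_cast h1
  nlinarith

/-- Here `g` is an eighth of the average number of relevant heights per tube, so by Cauchy–Schwarz
over the tubes dropping the closer pairs costs at most half of all pairs. Each remaining ordered
pair has at least `m / 4` transversals. -/
lemma card_configs_ge {g : ℝ} (hg : 1 / 2 ≤ g) (hgm : 8 * S.J.card * g = K.mass) :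
    m * K.mass ^ 2 ≤ 16 * S.J.card * (K.configs g).card := by
  have h1 : (m : ℝ) * ∑ j ∈ S.J, ((K.pairs g j).card : ℝ) ≤ 4 * (K.configs g).card := by
    have : m * ∑ j ∈ S.J, (K.pairs g j).card ≤ 4 * (K.configs g).card := by
      simp only [configs, Finset.card_sigma, Finset.mul_sum]
      refine Finset.sum_le_sum fun j _ => ?_
      rw [mul_comm, ← smul_eq_mul]
      refine Finset.card_nsmul_le_sum _ _ _ fun q hq => ?_
      rw [pairs, Finset.mem_filter, Finset.mem_product] at hq
      exact K.many _ _ (K.mem_relevant.mp hq.1.2).2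
    exact_mod_cast this
  have h2 : ∑ j ∈ S.J, (((K.relevant j).card : ℝ) ^ 2 - 4 * g * (K.relevant j).card) ≤
      2 * ∑ j ∈ S.J, ((K.pairs g j).card : ℝ) := by
    rw [Finset.mul_sum]
    exact Finset.sum_le_sum fun j _ => K.two_mul_card_pairs_ge hg j
  rw [Finset.sum_sub_distrib, ← Finset.mul_sum] at h2
  have h3 : K.mass ^ 2 ≤ S.J.card * ∑ j ∈ S.J, ((K.relevant j).card : ℝ) ^ 2 :=
    sq_sum_le_card_mul_sum_sq
  change _ - 4 * g * K.mass ≤ _ at h2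
  have hN : (0 : ℝ) ≤ S.J.card := by positivity
  have h4 : K.mass ^ 2 ≤ 4 * S.J.card * ∑ j ∈ S.J, ((K.pairs g j).card : ℝ) := by
    have := mul_le_mul_of_nonneg_left h2 hN
    have h5 : S.J.card * (4 * g * K.mass) = K.mass ^ 2 / 2 := by rw [← hgm]; ring
    nlinarith
  calc m * K.mass ^ 2 ≤ m * (4 * S.J.card * ∑ j ∈ S.J, ((K.pairs g j).card : ℝ)) := by gcongr
    _ = 4 * S.J.card * (m * ∑ j ∈ S.J, ((K.pairs g j).card : ℝ)) := by ring
    _ ≤ 4 * S.J.card * (4 * (K.configs g).card) := by gcongr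
    _ = _ := by ring

/-! ### First factor of Cauchy–Schwarz: the sum of inverse angles -/

/-- The angle of a tube with the central tube at a point. -/
noncomputable def angle (b : (ℂ × ℤ) × ι) : ℝ := ‖S.ω b.2 - S.ω (K.ctr b.1)‖

/-- The first point and the transversal tube of a configuration. -/
def base (w : Σ _ : ι, Σ _ : ℤ × ℤ, ι) : (ℂ × ℤ) × ι := (S.pt w.1 w.2.1.1, w.2.2)

/-- The points of `t` of low multiplicity near the central tube at `y`. -/
noncomputable def lowNear (y : ℂ × ℤ) (t : ι) : Finset ℤ :=
  (S.heights t).filter fun h => S.mult (S.pt t h) < H ∧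
    ‖S.c t h - (S.p (K.ctr y) + h * S.ω (K.ctr y))‖ ≤ 7 * (S.n * K.ρ y)

/-- Transversality holds at the second point; the ordering of the two scales transfers it to the
first, where `j` is within `ρ` of the central tube. Thus the angle between `t` and `j` is comparable
to one depending only on the base. -/
lemma angle_bounds {g : ℝ} {j t : ι} {s s' : ℤ}
    (hw : (⟨j, (s, s'), t⟩ : Σ _ : ι, Σ _ : ℤ × ℤ, ι) ∈ K.configs g) :
    63 * K.ρ (S.pt j s) < K.angle (S.pt j s, t) ∧
      K.angle (S.pt j s, t) ≤ 65 / 64 * ‖S.ω t - S.ω j‖ ∧ 0 < K.ρ (S.pt j s) := by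
  rw [mem_configs] at hw
  obtain ⟨hj, hs, hs', hρ, -, -, htr, -⟩ := hw
  have hκ := (K.mem_relevant.mp hs).2
  have h1 := K.κ_near _ _ hκ
  have h2 := K.two_le _ ⟨_, hκ⟩
  have hpos : 0 < K.ρ (S.pt j s) := by
    by_contra h
    have := S.n_pos
    nlinarith
  have h3 : ‖S.ω t - S.ω j‖ ≤ K.angle (S.pt j s, t) + ‖S.ω j - S.ω (K.ctr (S.pt j s))‖ := by
    have : S.ω t - S.ω j = (S.ω t - S.ω (K.ctr (S.pt j s))) -
      (S.ω j - S.ω (K.ctr (S.pt j s))) := by ring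
    rw [this]; exact norm_sub_le _ _
  have h4 : K.angle (S.pt j s, t) ≤ ‖S.ω t - S.ω j‖ + ‖S.ω j - S.ω (K.ctr (S.pt j s))‖ := by
    have : S.ω t - S.ω (K.ctr (S.pt j s)) = (S.ω t - S.ω j) +
      (S.ω j - S.ω (K.ctr (S.pt j s))) := by ring
    rw [angle, this]; exact norm_add_le _ _
  exact ⟨by linarith, by linarith, hpos⟩

/-- A transversal tube that is not bad has many points of low multiplicity near the central
tube. -/
lemma inv_angle_le {g : ℝ} {j t : ι} {s s' : ℤ}
    (hw : (⟨j, (s, s'), t⟩ : Σ _ : ι, Σ _ : ℤ × ℤ, ι) ∈ K.configs g) :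
    1 / K.angle (S.pt j s, t) ≤
      2 / (S.n * K.ρ (S.pt j s)) * (K.lowNear (S.pt j s) t).card := by
  obtain ⟨hθ1, -, hpos⟩ := K.angle_bounds hw
  rw [mem_configs] at hw
  obtain ⟨hj, hs, hs', hρ, -, ht, htr, hbad⟩ := hw
  have hsh := (K.mem_relevant.mp hs).1
  have hsh' := (K.mem_relevant.mp hs').1
  have hκ := (K.mem_relevant.mp hs).2
  set y := S.pt j s with hy
  set k := K.ctr y with hk
  set ρ := K.ρ y with hρd
  set θ := K.angle (y, t) with hθ
  have hk' := K.ctr_mem y ⟨_, hκ⟩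
  rw [← hk, hy, mem_tubesAt_pt] at hk'
  rw [mem_tubesAt_pt] at ht
  have hr2 := K.two_le y ⟨_, hκ⟩
  have hθ4 : θ ≤ 4 := S.norm_sub_le_four ht.1 hk'.1
  have hθpos : 0 < θ := by linarith
  set r := S.n * ρ with hr
  have hnpos := S.n_pos
  have hone : 1 ≤ 2 * r / θ := by rw [le_div_iff₀ hθpos]; linarith
  -- Over `2 ^ d ≤ 2 r / θ` heights `t` drifts by at most `2 r` from the central tube; this length
  -- is optimal up to a factor 2.
  obtain ⟨d, hd1, hd2⟩ := exists_nat_pow_near hone (show (1 : ℝ) < 2 by norm_num)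
  have hd : d ≤ S.e := by
    have : (2 : ℝ) ^ d ≤ 2 ^ S.e := by
      refine hd1.trans ?_
      rw [div_le_iff₀ hθpos]
      change 2 * (S.n * ρ) ≤ S.n * θ
      nlinarith
    exact (pow_le_pow_iff_right₀ (by norm_num)).mp this
  have hgood := S.card_good_ge _ ht.2.1 hbad hd
  have hcl1 := S.axis_close hj hk'.1 hsh hk'.2.1 hk'.2.2.symm
  have hcl2 := S.axis_close ht.1 hj ht.2.1 hsh' ht.2.2
  have hdist : |(s' : ℝ) - s| ≤ S.n := by
    rw [heights, Finset.mem_Ico] at hsh hsh'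
    have h1 : (S.σ j : ℝ) ≤ s := by exact_mod_cast hsh.1
    have h2 : (S.σ j : ℝ) ≤ s' := by exact_mod_cast hsh'.1
    have h3 : (s : ℝ) < S.σ j + S.n := by unfold n; exact_mod_cast hsh.2
    have h4 : (s' : ℝ) < S.σ j + S.n := by unfold n; exact_mod_cast hsh'.2
    rw [abs_le]; constructor <;> linarith
  have hjk := K.κ_near y _ hκ
  -- At height `s'` the tube `t` is near `j`; at height `s` the tube `j` is near `k`, and between
  -- the two heights they diverge by at most `n * ρ = r`. With the rounding `1 / 4` and the drift `2
  -- r`, the total stays below `7 r` since `2 ≤ r`.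
  have hDs' : ‖(S.p t - S.p k) + s' * (S.ω t - S.ω k)‖ ≤ 1 + r := by
    have heq : (S.p t - S.p k) + s' * (S.ω t - S.ω k) =
        ((S.p t - S.p j) + s' * (S.ω t - S.ω j)) + ((S.p j - S.p k) + s * (S.ω j - S.ω k)) +
          (((s' : ℝ) - s : ℝ) : ℂ) * (S.ω j - S.ω k) := by push_cast; ring
    rw [heq]
    refine (norm_add_le _ _).trans ?_
    have h1 := (norm_add_le ((S.p t - S.p j) + s' * (S.ω t - S.ω j))
      ((S.p j - S.p k) + s * (S.ω j - S.ω k)))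
    have h2 : ‖(((s' : ℝ) - s : ℝ) : ℂ) * (S.ω j - S.ω k)‖ ≤ r := by
      rw [norm_mul, Complex.norm_real, Real.norm_eq_abs]
      exact mul_le_mul hdist hjk (norm_nonneg _) hnpos.le
    linarith
  have hmem : ∀ h : ℤ, (h ∈ S.heights t ∧ |(h : ℝ) - s'| < 2 ^ d ∧ ¬ H ≤ S.mult (S.pt t h)) →
      h ∈ K.lowNear y t := by
    intro h hh
    rw [lowNear, Finset.mem_filter]
    refine ⟨hh.1, not_le.mp hh.2.2, ?_⟩
    have hnear := S.near t ht.1 h hh.1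
    have heq : S.c t h - (S.p k + h * S.ω k) = (S.c t h - (S.p t + h * S.ω t)) +
        ((S.p t - S.p k) + s' * (S.ω t - S.ω k)) +
          (((h : ℝ) - s' : ℝ) : ℂ) * (S.ω t - S.ω k) := by push_cast; ring
    rw [← hk, heq]
    refine (norm_add_le _ _).trans ?_
    have h1 := norm_add_le (S.c t h - (S.p t + h * S.ω t))
      ((S.p t - S.p k) + s' * (S.ω t - S.ω k))
    have h2 : ‖(((h : ℝ) - s' : ℝ) : ℂ) * (S.ω t - S.ω k)‖ ≤ 2 * r := by
      rw [norm_mul, Complex.norm_real, Real.norm_eq_abs]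
      have h3 : |(h : ℝ) - s'| ≤ 2 * r / θ := (hh.2.1.le).trans hd1
      calc |(h : ℝ) - s'| * θ ≤ 2 * r / θ * θ := mul_le_mul_of_nonneg_right h3 hθpos.le
        _ = 2 * r := div_mul_cancel₀ _ hθpos.ne'
    linarith
  have hcard := hgood.trans (Nat.mul_le_mul_left 2 (Finset.card_le_card fun h hh =>
    hmem h (by simpa only [Finset.mem_filter] using hh)))
  have hcard' : (2 : ℝ) ^ d ≤ 2 * (K.lowNear y t).card := by exact_mod_cast hcard
  rw [pow_succ, div_lt_iff₀ hθpos] at hd2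
  rw [div_mul_eq_mul_div, div_le_div_iff₀ hθpos (by positivity)]
  have h5 := mul_le_mul_of_nonneg_right hcard' hθpos.le
  linarith

/-- The points at which `κ` is nonempty. -/
noncomputable def support : Finset (ℂ × ℤ) := S.points.filter fun a => (K.κ a).Nonempty

/-- Counted by points: each point involved lies on fewer than `H` tubes, and all lie in a fat tube
of radius `7 * (S.n * K.ρ y)`. -/
lemma sum_lowNear_le {D : ℝ} (hD : S.FatBound D) {y : ℂ × ℤ} (hy : (K.κ y).Nonempty) :
    ∑ t ∈ S.J, ((K.lowNear y t).card : ℝ) ≤ H * (D * (S.n * K.ρ y) * S.n) := by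
  set N : ℂ × ℤ → Prop := fun a => ‖a.1 - (S.p (K.ctr y) + a.2 * S.ω (K.ctr y))‖ ≤
    7 * (S.n * K.ρ y) with hN
  have h := S.sum_incidence fun _ a => if S.mult a < H ∧ N a then (1 : ℝ) else 0
  have h1 : ∀ t, ((K.lowNear y t).card : ℝ) =
      ∑ s ∈ S.heights t, if S.mult (S.pt t s) < H ∧ N (S.pt t s) then (1 : ℝ) else 0 :=
    fun t => by rw [Finset.sum_boole, lowNear]; rfl
  simp only [h1]
  rw [h]
  have hfat := hD (S.p (K.ctr y)) (S.ω (K.ctr y)) (S.n * K.ρ y)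
    (S.norm_ω_le _ (S.mem_tubesAt.mp (K.ctr_mem y hy)).1) (by linarith [K.two_le y hy]) (by have := K.ρ_le y hy; nlinarith [S.n_pos])
  refine le_trans ?_ (mul_le_mul_of_nonneg_left hfat (Nat.cast_nonneg H))
  rw [mul_comm (H : ℝ), Finset.card_filter, Nat.cast_sum, Finset.sum_mul]
  refine Finset.sum_le_sum fun a _ => ?_
  rw [Finset.sum_const, nsmul_eq_mul]
  by_cases hc : S.mult a < H ∧ N a
  · have h2 : ‖a.1 - (S.p (K.ctr y) + a.2 * S.ω (K.ctr y))‖ ≤ 7 * (S.n * K.ρ y) := hc.2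
    rw [if_pos hc, if_pos h2]
    have : (S.mult a : ℝ) ≤ H := by exact_mod_cast hc.1.le
    simpa [mult] using this
  · rw [if_neg hc, mul_zero]; positivity

/-- The radius `n * ρ` cancels between `inv_angle_le` and the fat tube bound, so every first point
contributes at most `2 * H * D * n`, whatever its scale. -/
lemma sum_inv_angle_le {D g : ℝ} (hD : S.FatBound D) :
    ∑ b ∈ (K.configs g).image (base (S := S)), 1 / K.angle b ≤
      K.support.card * (2 * H * D * S.n) := by
  have hle : ∀ b ∈ (K.configs g).image (base (S := S)), b ∈ K.support ×ˢ S.J ∧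
      1 / K.angle b ≤ 2 / (S.n * K.ρ b.1) * (K.lowNear b.1 b.2).card := by
    intro b hb
    rw [Finset.mem_image] at hb
    obtain ⟨⟨j, ⟨s, s'⟩, t⟩, hw, rfl⟩ := hb
    refine ⟨?_, K.inv_angle_le hw⟩
    rw [mem_configs] at hw
    obtain ⟨hj, hs, hs', -, -, ht, -, -⟩ := hw
    have hs := K.mem_relevant.mp hs
    rw [base, Finset.mem_product, support, Finset.mem_filter]
    exact ⟨⟨S.pt_mem_points hj hs.1, ⟨_, hs.2⟩⟩, (S.mem_tubesAt_pt.mp ht).1⟩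
  have hpos : ∀ y ∈ K.support, 0 < S.n * K.ρ y := fun y hy => by
    linarith [K.two_le y (Finset.mem_filter.mp hy).2]
  calc ∑ b ∈ (K.configs g).image (base (S := S)), 1 / K.angle b
      ≤ ∑ b ∈ (K.configs g).image (base (S := S)),
          2 / (S.n * K.ρ b.1) * (K.lowNear b.1 b.2).card := Finset.sum_le_sum fun b hb => (hle b hb).2
    _ ≤ ∑ b ∈ K.support ×ˢ S.J, 2 / (S.n * K.ρ b.1) * (K.lowNear b.1 b.2).card := by
        refine Finset.sum_le_sum_of_subset_of_nonneg (fun b hb => (hle b hb).1) fun b hb _ => ?_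
        have := hpos b.1 (Finset.mem_product.mp hb).1
        positivity
    _ = ∑ y ∈ K.support, 2 / (S.n * K.ρ y) * ∑ t ∈ S.J, ((K.lowNear y t).card : ℝ) := by
        rw [Finset.sum_product]
        exact Finset.sum_congr rfl fun y _ => by rw [Finset.mul_sum]
    _ ≤ ∑ y ∈ K.support, 2 * H * D * S.n := by
        refine Finset.sum_le_sum fun y hy => ?_
        have h0 := hpos y hy
        refine (mul_le_mul_of_nonneg_left (K.sum_lowNear_le hD (Finset.mem_filter.mp hy).2)
          (by positivity)).trans (le_of_eq ?_)
        have hρ : K.ρ y ≠ 0 := fun h => by rw [h, mul_zero] at h0; exact lt_irrefl _ h0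
        have hn := S.n_pos.ne'
        field_simp
    _ = _ := by rw [Finset.sum_const, nsmul_eq_mul]

/-! ### Second factor of Cauchy–Schwarz: coplanar tubes -/

/-- The configurations with given base. -/
noncomputable def fiber (g : ℝ) (b : (ℂ × ℤ) × ι) : Finset (Σ _ : ι, Σ _ : ℤ × ℤ, ι) :=
  (K.configs g).filter fun w => base (S := S) w = b

/-- The first tubes of the configurations with given base. -/
noncomputable def links (g : ℝ) (b : (ℂ × ℤ) × ι) : Finset ι := (K.fiber g b).image Sigma.fst

lemma mem_fiber {g : ℝ} {b : (ℂ × ℤ) × ι} {w : Σ _ : ι, Σ _ : ℤ × ℤ, ι} :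
    w ∈ K.fiber g b ↔ w ∈ K.configs g ∧ base (S := S) w = b := by
  rw [fiber, Finset.mem_filter]

lemma mem_links {g : ℝ} {b : (ℂ × ℤ) × ι} {j : ι} (h : j ∈ K.links g b) :
    ∃ s' : ℤ, (⟨j, (b.1.2, s'), b.2⟩ : Σ _ : ι, Σ _ : ℤ × ℤ, ι) ∈ K.configs g ∧
      S.pt j b.1.2 = b.1 := by
  rw [links, Finset.mem_image] at h
  obtain ⟨⟨j', ⟨s, s'⟩, t⟩, hw, rfl⟩ := h
  rw [mem_fiber] at hw
  obtain ⟨hw, rfl⟩ := hw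
  exact ⟨s', hw, rfl⟩

/-- Once `j` is known, only the height where it meets `t` is free. The number of such heights is
about the inverse angle, which the weight cancels. -/
lemma angle_mul_card_fiber_le (g : ℝ) (b : (ℂ × ℤ) × ι) :
    K.angle b * (K.fiber g b).card ≤ 6 * (K.links g b).card := by
  have hmaps : ∀ w ∈ K.fiber g b, w.1 ∈ K.links g b := fun w hw => Finset.mem_image_of_mem _ hw
  rw [Finset.card_eq_sum_card_fiberwise hmaps]
  push_cast
  rw [Finset.mul_sum, mul_comm, ← nsmul_eq_mul]
  refine Finset.sum_le_card_nsmul _ _ _ fun j hj => ?_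
  obtain ⟨s', hw, hpt⟩ := K.mem_links hj
  obtain ⟨h1, h2, h3⟩ := K.angle_bounds hw
  rw [mem_configs] at hw
  obtain ⟨hj', -, -, -, -, ht, -, -⟩ := hw
  rw [hpt] at h1 h2 h3
  change _ < K.angle b at h1
  change K.angle b ≤ _ at h2
  rw [mem_tubesAt_pt] at ht
  have hcard : ((K.fiber g b).filter fun w => w.1 = j).card ≤ (S.meet b.2 j).card := by
    refine Finset.card_le_card_of_injOn (fun w => w.2.1.2) ?_ ?_
    · rintro ⟨j₁, ⟨s₁, s₂⟩, t⟩ hw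
      simp only [Finset.coe_filter, Set.mem_ofPred_eq, mem_fiber] at hw
      obtain ⟨⟨hw, rfl⟩, rfl⟩ := hw
      rw [mem_configs] at hw
      obtain ⟨-, -, hs, -, -, ht, -, -⟩ := hw
      rw [mem_tubesAt_pt] at ht
      rw [meet, Finset.mem_coe, Finset.mem_filter]
      exact ⟨ht.2.1, (K.mem_relevant.mp hs).1, ht.2.2⟩
    · rintro ⟨j₁, ⟨s₁, s₂⟩, t⟩ hw ⟨j₂, ⟨s₃, s₄⟩, t'⟩ hw' heq
      simp only [Finset.coe_filter, Set.mem_ofPred_eq, mem_fiber] at hw hw'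
      obtain ⟨⟨-, rfl⟩, rfl⟩ := hw
      obtain ⟨⟨-, h⟩, h'⟩ := hw'
      simp only [base, pt, Prod.mk.injEq] at h heq
      obtain ⟨⟨-, rfl⟩, rfl⟩ := h
      subst h' heq
      rfl
  set x := ‖S.ω b.2 - S.ω j‖ with hx
  have hxpos : 0 < x := by linarith
  have hne : S.ω b.2 ≠ S.ω j := fun h0 => by rw [hx, h0, sub_self, norm_zero] at hxpos; linarith
  have hm := S.card_meet_le ht.1 hj' hne
  have hx4 : x ≤ 4 := S.norm_sub_le_four ht.1 hj'
  have hcard' : (((K.fiber g b).filter fun w => w.1 = j).card : ℝ) ≤ 1 / x + 1 :=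
    le_trans (by exact_mod_cast hcard) hm
  calc K.angle b * ((K.fiber g b).filter fun w => w.1 = j).card
      ≤ (65 / 64 * x) * (1 / x + 1) := by gcongr
    _ = 65 / 64 + 65 / 64 * x := by field_simp
    _ ≤ 6 := by linarith

/-- Triples of a tube, a relevant height on it and a tube through the corresponding point. -/
noncomputable def triples : Finset (Σ _ : ι, Σ _ : ℤ, ι) :=
  S.J.sigma fun j => (K.relevant j).sigma fun s => S.tubesAt (S.pt j s)

lemma card_triples_le : (K.triples.card : ℝ) ≤ H * K.mass := by
  have : K.triples.card ≤ H * ∑ j ∈ S.J, (K.relevant j).card := by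
    simp only [triples, Finset.card_sigma, Finset.mul_sum]
    refine Finset.sum_le_sum fun j _ => ?_
    rw [mul_comm, ← smul_eq_mul]
    refine Finset.sum_le_card_nsmul _ _ _ fun s hs => ?_
    exact (K.mult_bounds _ ⟨_, (K.mem_relevant.mp hs).2⟩).2.le
  rw [mass]
  exact_mod_cast this

/-- The end of a configuration. -/
def tail (w : Σ _ : ι, Σ _ : ℤ × ℤ, ι) : Σ _ : ι, Σ _ : ℤ, ι := ⟨w.1, w.2.1.2, w.2.2⟩

lemma tail_mem_triples {g : ℝ} {w : Σ _ : ι, Σ _ : ℤ × ℤ, ι} (hw : w ∈ K.configs g) :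
    tail w ∈ K.triples := by
  obtain ⟨j, ⟨s, s'⟩, t⟩ := w
  rw [mem_configs] at hw
  simp only [triples, Finset.mem_sigma, tail]
  exact ⟨hw.1, hw.2.2.1, hw.2.2.2.2.2.1⟩

/-- The tubes through two tubes which meet have slopes near the line spanned by the difference
of their slopes. -/
lemma exists_near_line {g : ℝ} (hg : 0 < g) {j k t : ι} {s s' s'' : ℤ}
    (hw : (⟨j, (s, s'), t⟩ : Σ _ : ι, Σ _ : ℤ × ℤ, ι) ∈ K.configs g)
    (hw' : (⟨k, (s, s''), t⟩ : Σ _ : ι, Σ _ : ℤ × ℤ, ι) ∈ K.configs g)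
    (hpt : S.c k s = S.c j s) :
    ∃ x : ℝ, ‖(S.ω k - S.ω j) - x * (S.ω j - S.ω t)‖ ≤ 3 / 2 / g := by
  rw [mem_configs] at hw hw'
  obtain ⟨hj, hs, hs', -, -, ht, -, -⟩ := hw
  obtain ⟨hk, hks, hs'', -, hgs, ht', -, -⟩ := hw'
  rw [mem_tubesAt_pt] at ht ht'
  have hs := (K.mem_relevant.mp hs).1
  have hs' := (K.mem_relevant.mp hs').1
  have hs'' := (K.mem_relevant.mp hs'').1
  have hks := (K.mem_relevant.mp hks).1
  have h1 := S.axis_close hk hj hks hs hpt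
  have h2 := S.axis_close hj ht.1 hs' ht.2.1 ht.2.2.symm
  have h3 := S.axis_close hk ht.1 hs'' ht'.2.1 ht'.2.2.symm
  set x : ℝ := (s' - s'') / (s'' - s) with hx
  refine ⟨x, ?_⟩
  have hne : ((s'' : ℝ) - s) ≠ 0 := fun h0 => by
    rw [abs_sub_comm, h0, abs_zero] at hgs; linarith
  rw [le_div_iff₀ hg]
  -- This combination of the three closeness relations, one for each vertex of the triangle formed
  -- by `j`, `k`, `t`, eliminates the positions `p`; each contributes at most `1 / 2`.
  have heq : (((s'' : ℝ) - s : ℝ) : ℂ) * ((S.ω k - S.ω j) - x * (S.ω j - S.ω t)) =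
      ((S.p k - S.p t) + s'' * (S.ω k - S.ω t)) - ((S.p k - S.p j) + s * (S.ω k - S.ω j)) -
        ((S.p j - S.p t) + s' * (S.ω j - S.ω t)) := by
    have hxx : (((s'' : ℝ) - s : ℝ) : ℂ) * (x : ℂ) = ((s' : ℝ) - s'' : ℝ) := by
      rw [← Complex.ofReal_mul, hx, mul_div_cancel₀ _ hne]
    rw [mul_sub, ← mul_assoc, hxx]
    push_cast; ring
  have hnorm : |(s'' : ℝ) - s| * ‖(S.ω k - S.ω j) - x * (S.ω j - S.ω t)‖ ≤ 3 / 2 := by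
    rw [← Real.norm_eq_abs, ← Complex.norm_real, ← norm_mul, heq]
    refine (norm_sub_le _ _).trans ?_
    have := norm_sub_le ((S.p k - S.p t) + s'' * (S.ω k - S.ω t))
      ((S.p k - S.p j) + s * (S.ω k - S.ω j))
    linarith
  rw [abs_sub_comm] at hgs
  refine le_trans ?_ hnorm
  rw [mul_comm]
  exact mul_le_mul_of_nonneg_right hgs (norm_nonneg _)

/-- With `j`, `s'`, `t` fixed, this counts pairs of a height `s` and a tube `k` through that point
of `j` that meets `t`. Each `k` allows at most `10 n / (1 + n * ‖ω k - ω j‖)` heights `s`, and its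
slope lies in the strip of `exists_near_line`; `sum_inv_strip_le` sums these. -/
lemma sum_links_tail_le {M g : ℝ} (hM : S.DirSep M) (hM0 : 0 ≤ M) (hg : 0 < g)
    (τ : Σ _ : ι, Σ _ : ℤ, ι) :
    ∑ w ∈ K.configs g with tail w = τ, ((K.links g (base (S := S) w)).card : ℝ) ≤
      10 * S.n * (20 * M * (4 * (S.n * (3 / 2 / g)) + 2) * (S.e + 1)) := by
  obtain ⟨j, s', t⟩ := τ
  set G := (K.configs g).filter fun w => tail w = ⟨j, s', t⟩ with hG
  set V := S.J.filter fun k => ∃ w ∈ G, k ∈ K.links g (base (S := S) w) with hV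
  have hnpos := S.n_pos
  rcases V.eq_empty_or_nonempty with hVe | ⟨k₀, hk₀⟩
  · have : ∀ w ∈ G, ((K.links g (base (S := S) w)).card : ℝ) = 0 := by
      intro w hw
      rw [Nat.cast_eq_zero, Finset.card_eq_zero, Finset.eq_empty_iff_forall_notMem]
      intro k hk
      obtain ⟨s₁, hc, -⟩ := K.mem_links hk
      have : k ∈ V := by
        rw [hV, Finset.mem_filter]
        exact ⟨(K.mem_configs.mp hc).1, w, hw, hk⟩
      rw [hVe] at this
      simp at this
    rw [Finset.sum_eq_zero this]
    positivity
  have hGw : ∀ w ∈ G, ∃ s : ℤ, w = ⟨j, (s, s'), t⟩ ∧ w ∈ K.configs g := by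
    rintro ⟨j₁, ⟨s₁, s₂⟩, t₁⟩ hw
    rw [hG, Finset.mem_filter] at hw
    obtain ⟨hw, h⟩ := hw
    simp only [tail, Sigma.mk.injEq, heq_eq_eq] at h
    obtain ⟨rfl, rfl, rfl⟩ := h
    exact ⟨s₁, rfl, hw⟩
  have hVk : ∀ k ∈ V, ∃ s s'' : ℤ,
      (⟨j, (s, s'), t⟩ : Σ _ : ι, Σ _ : ℤ × ℤ, ι) ∈ K.configs g ∧
      (⟨k, (s, s''), t⟩ : Σ _ : ι, Σ _ : ℤ × ℤ, ι) ∈ K.configs g ∧ S.c k s = S.c j s := by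
    intro k hk
    rw [hV, Finset.mem_filter] at hk
    obtain ⟨-, w, hw, hkl⟩ := hk
    obtain ⟨s, rfl, hw⟩ := hGw w hw
    obtain ⟨s'', hc, hpt⟩ := K.mem_links hkl
    exact ⟨s, s'', hw, hc, congrArg Prod.fst hpt⟩
  have hwne : S.ω j - S.ω t ≠ 0 := by
    obtain ⟨s, s'', hw, -, -⟩ := hVk k₀ hk₀
    obtain ⟨-, h2, h3⟩ := K.angle_bounds hw
    obtain ⟨h1, -, -⟩ := K.angle_bounds hw
    intro h0
    rw [← neg_sub, neg_eq_zero] at h0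
    rw [h0, norm_zero] at h2
    linarith
  have hjJ : j ∈ S.J := by
    obtain ⟨s, s'', hw, -, -⟩ := hVk k₀ hk₀
    exact (K.mem_configs.mp hw).1
  have hVJ : ∀ k ∈ V, k ∈ S.J := fun k hk => (Finset.mem_filter.mp hk).1
  have hstrip := sum_inv_strip_le V (fun k => S.ω k - S.ω j) (S.ω j - S.ω t) S.e
    (δ := 3 / 2 / g) (B := M) hwne (by positivity) hM0
    (fun k hk => S.norm_sub_le_four (hVJ k hk) hjJ)
    (fun k hk => by
      obtain ⟨s, s'', hw, hw', hpt⟩ := hVk k hk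
      exact K.exists_near_line hg hw hw' hpt)
    (fun z => by
      refine le_trans ?_ (hM (z + S.ω j))
      refine Nat.cast_le.mpr (Finset.card_le_card fun k hk => ?_)
      rw [Finset.mem_filter] at hk ⊢
      refine ⟨hVJ k hk.1, ?_⟩
      have h := hk.2
      rw [show S.ω k - S.ω j - z = S.ω k - (z + S.ω j) by ring] at h
      unfold n
      exact h)
  change _ ≤ 20 * M * (4 * (S.n * (3 / 2 / g)) + 2) * (S.e + 1) at hstrip
  have hlinks : ∀ w ∈ G, ((K.links g (base (S := S) w)).card : ℝ) =
      ∑ k ∈ V, if k ∈ K.links g (base (S := S) w) then (1 : ℝ) else 0 := by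
    intro w hw
    rw [Finset.sum_boole, Finset.filter_mem_eq_inter, Finset.inter_eq_right.mpr]
    intro k hk
    obtain ⟨s₁, hc, -⟩ := K.mem_links hk
    rw [hV, Finset.mem_filter]
    exact ⟨(K.mem_configs.mp hc).1, w, hw, hk⟩
  rw [Finset.sum_congr rfl hlinks, Finset.sum_comm]
  refine le_trans (Finset.sum_le_sum fun k hk => ?_)
    (le_of_eq_of_le (Finset.mul_sum _ _ _).symm (mul_le_mul_of_nonneg_left hstrip (by positivity)))
  rw [Finset.sum_boole]
  refine le_trans ?_ (S.card_meet_le' (hVJ k hk) hjJ)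
  norm_cast
  refine Finset.card_le_card_of_injOn (fun w => w.2.1.1) ?_ ?_
  · intro w hw
    rw [Finset.mem_coe, Finset.mem_filter] at hw
    obtain ⟨hw, hkl⟩ := hw
    obtain ⟨s, rfl, hw⟩ := hGw w hw
    obtain ⟨s'', hc, hpt⟩ := K.mem_links hkl
    rw [mem_configs] at hw hc
    rw [meet, Finset.mem_coe, Finset.mem_filter]
    exact ⟨(K.mem_relevant.mp hc.2.1).1, (K.mem_relevant.mp hw.2.1).1, congrArg Prod.fst hpt⟩
  · intro w hw w' hw' h
    rw [Finset.mem_coe, Finset.mem_filter] at hw hw'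
    obtain ⟨s, rfl, -⟩ := hGw w hw.1
    obtain ⟨s₁, rfl, -⟩ := hGw w' hw'.1
    simp only at h
    rw [h]

/-! ### The Cauchy–Schwarz estimate -/

/-- The main estimate: double counting of configurations by Cauchy–Schwarz. -/
theorem mass_pow_le {M D : ℝ} (hM : S.DirSep M) (hM0 : 0 ≤ M) (hD : S.FatBound D)
    (hD0 : 0 ≤ D) (hmass : 4 * S.J.card ≤ K.mass) (hN : S.J.Nonempty) :
    (m : ℝ) ^ 2 * K.mass ^ 4 ≤
      39321600 * (H : ℝ) ^ 2 * K.support.card * D * M * (S.e + 1) * (S.n * S.J.card) ^ 3 := by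
  set N : ℝ := (S.J.card : ℝ) with hNd
  have hN1 : 1 ≤ N := by rw [hNd]; exact_mod_cast hN.card_pos
  have hnpos := S.n_pos
  set g : ℝ := K.mass / (8 * N) with hg
  have hgm : 8 * N * g = K.mass := by rw [hg, mul_div_cancel₀ _ (by positivity)]
  have hghalf : 1 / 2 ≤ g := by rw [hg, le_div_iff₀ (by positivity)]; linarith
  have hgpos : 0 < g := by linarith
  have hmn : K.mass ≤ N * S.n := by
    rw [mass, hNd, ← nsmul_eq_mul]
    refine Finset.sum_le_card_nsmul _ _ _ fun j _ => ?_
    have : (K.relevant j).card ≤ 2 ^ S.e := by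
      rw [← S.card_heights j]; exact Finset.card_filter_le _ _
    unfold n
    exact_mod_cast this
  have hgn : g ≤ S.n := by
    rw [hg, div_le_iff₀ (by positivity)]; nlinarith
  set W := K.configs g with hW
  set I := W.image (base (S := S)) with hI
  have hpos : ∀ b ∈ I, 0 < K.angle b := by
    intro b hb
    rw [hI, Finset.mem_image] at hb
    obtain ⟨⟨j, ⟨s, s'⟩, t⟩, hw, rfl⟩ := hb
    obtain ⟨h1, -, h3⟩ := K.angle_bounds hw
    exact lt_trans (by positivity) h1
  have hcardW : (W.card : ℝ) = ∑ b ∈ I, ((K.fiber g b).card : ℝ) := by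
    have := Finset.card_eq_sum_card_fiberwise (f := base (S := S)) (s := W) (t := I)
      fun w hw => Finset.mem_image_of_mem _ hw
    rw [this]; push_cast; rfl
  -- The weight `angle` in the second sum pays for the many heights at which nearly parallel `j` and
  -- `t` can meet; its inverse is affordable by the fat tube bound.
  have hCS : (W.card : ℝ) ^ 2 ≤ (∑ b ∈ I, 1 / K.angle b) *
      ∑ b ∈ I, K.angle b * ((K.fiber g b).card : ℝ) ^ 2 := by
    rw [hcardW]
    refine Finset.sum_sq_le_sum_mul_sum_of_sq_le_mul _ (fun b hb => ?_) (fun b hb => ?_)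
      fun b hb => ?_
    · have := hpos b hb; positivity
    · have := hpos b hb; positivity
    · have := (hpos b hb).ne'; exact le_of_eq (by field_simp)
  have hB1 : ∑ b ∈ I, 1 / K.angle b ≤ K.support.card * (2 * H * D * S.n) :=
    K.sum_inv_angle_le hD
  have hB2 : ∑ b ∈ I, K.angle b * ((K.fiber g b).card : ℝ) ^ 2 ≤
      6 * (H * K.mass * (1600 * S.n ^ 2 * M * (S.e + 1) / g)) := by
    calc ∑ b ∈ I, K.angle b * ((K.fiber g b).card : ℝ) ^ 2
        ≤ ∑ b ∈ I, ∑ w ∈ W with base (S := S) w = b,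
            6 * ((K.links g (base (S := S) w)).card : ℝ) := by
          refine Finset.sum_le_sum fun b _ => ?_
          rw [Finset.sum_congr rfl (g := fun _ => 6 * ((K.links g b).card : ℝ))
            (fun w hw => by rw [(Finset.mem_filter.mp hw).2]), Finset.sum_const, nsmul_eq_mul]
          have h1 := mul_le_mul_of_nonneg_left (K.angle_mul_card_fiber_le g b)
            (Nat.cast_nonneg (α := ℝ) (K.fiber g b).card)
          refine le_trans (le_of_eq ?_) h1
          ring
      _ = 6 * ∑ w ∈ W, ((K.links g (base (S := S) w)).card : ℝ) := by
          rw [Finset.sum_fiberwise_of_maps_to fun w hw => Finset.mem_image_of_mem _ hw,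
            Finset.mul_sum]
      _ = 6 * ∑ τ ∈ K.triples, ∑ w ∈ W with tail w = τ,
            ((K.links g (base (S := S) w)).card : ℝ) := by
          rw [Finset.sum_fiberwise_of_maps_to fun w hw => K.tail_mem_triples hw]
      _ ≤ 6 * ∑ τ ∈ K.triples, 1600 * S.n ^ 2 * M * (S.e + 1) / g := by
          refine mul_le_mul_of_nonneg_left (Finset.sum_le_sum fun τ _ => ?_) (by norm_num)
          refine (K.sum_links_tail_le hM hM0 hgpos τ).trans ?_
          have h2 : 4 * (S.n * (3 / 2 / g)) + 2 ≤ 8 * S.n / g := by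
            rw [le_div_iff₀ hgpos, add_mul]
            have : 4 * (S.n * (3 / 2 / g)) * g = 6 * S.n := by field_simp; norm_num
            linarith
          calc 10 * S.n * (20 * M * (4 * (S.n * (3 / 2 / g)) + 2) * (S.e + 1))
              ≤ 10 * S.n * (20 * M * (8 * S.n / g) * (S.e + 1)) := by gcongr
            _ = _ := by ring
      _ ≤ _ := by
          rw [Finset.sum_const, nsmul_eq_mul]
          have := K.card_triples_le
          gcongr
  have hlow := K.card_configs_ge hghalf hgm
  have hmass0 : 0 < K.mass := by linarith
  have hsq : ((m : ℝ) * K.mass ^ 2) ^ 2 ≤ (16 * N * W.card) ^ 2 := by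
    have : (0 : ℝ) ≤ m * K.mass ^ 2 := by positivity
    exact pow_le_pow_left₀ this hlow 2
  have hB20 : 0 ≤ ∑ b ∈ I, K.angle b * ((K.fiber g b).card : ℝ) ^ 2 :=
    Finset.sum_nonneg fun b hb => by have := hpos b hb; positivity
  have hprod := hCS.trans (mul_le_mul hB1 hB2 hB20 (by positivity))
  calc (m : ℝ) ^ 2 * K.mass ^ 4 = ((m : ℝ) * K.mass ^ 2) ^ 2 := by ring
    _ ≤ (16 * N * W.card) ^ 2 := hsq
    _ = 256 * N ^ 2 * (W.card : ℝ) ^ 2 := by ring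
    _ ≤ 256 * N ^ 2 * (K.support.card * (2 * H * D * S.n) *
          (6 * (H * K.mass * (1600 * S.n ^ 2 * M * (S.e + 1) / g)))) := by gcongr
    -- The remaining `mass / g` equals `8 * N`, so no power of the mass survives on the right.
    _ = 39321600 * (H : ℝ) ^ 2 * K.support.card * D * M * (S.e + 1) * (S.n * N) ^ 3 := by
        rw [← hgm]; field_simp; ring

end Concentration

end TubeConfig

/-! ### Choice of the multiplicity level -/

/-- A level at which a function decays quickly, without losing cubic mass. -/
lemma exists_level (F : ℕ → ℕ) {m₀ B : ℕ} (hB : ∀ k, B < k → F k = 0) (h₀ : F m₀ ≠ 0)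
    (hpos : 0 < m₀) :
    ∃ m, m₀ ≤ m ∧ F m ≠ 0 ∧ 18 * F (104976 * m) ≤ F m ∧ m₀ * F m₀ ^ 3 ≤ m * F m ^ 3 := by
  have hm₀B : m₀ ≤ B := by
    by_contra h
    exact h₀ (hB _ (not_le.mp h))
  -- Maximizing `k * F k ^ 4` gives the decay because `104976 = 18 ^ 4`.
  obtain ⟨m, hm, hmax⟩ := Finset.exists_max_image (Finset.Icc m₀ B) (fun k => k * F k ^ 4)
    ⟨m₀, Finset.mem_Icc.mpr ⟨le_rfl, hm₀B⟩⟩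
  rw [Finset.mem_Icc] at hm
  have hmax' : ∀ k, m₀ ≤ k → k * F k ^ 4 ≤ m * F m ^ 4 := by
    intro k hk
    by_cases hkB : k ≤ B
    · exact hmax k (Finset.mem_Icc.mpr ⟨hk, hkB⟩)
    · rw [hB k (not_le.mp hkB)]; simp
  have hmpos : 0 < m := by omega
  have hmm := hmax' m₀ le_rfl
  have hFm : F m ≠ 0 := by
    intro h
    rw [h] at hmm
    have : 0 < m₀ * F m₀ ^ 4 := by positivity
    simp at hmm
    omega
  refine ⟨m, hm.1, hFm, ?_, ?_⟩
  · have h := hmax' (104976 * m) (by omega)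
    have h1 : m * (18 * F (104976 * m)) ^ 4 ≤ m * F m ^ 4 := by
      refine le_trans (le_of_eq ?_) h
      ring
    exact (Nat.pow_le_pow_iff_left (by norm_num)).mp (Nat.le_of_mul_le_mul_left h1 hmpos)
  · refine (Nat.pow_le_pow_iff_left (n := 4) (by norm_num)).mp ?_
    calc (m₀ * F m₀ ^ 3) ^ 4 = m₀ * (m₀ * F m₀ ^ 4) ^ 3 := by ring
      _ ≤ m * (m * F m ^ 4) ^ 3 := Nat.mul_le_mul hm.1 (Nat.pow_le_pow_left hmm 3)
      _ = (m * F m ^ 3) ^ 4 := by ring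

namespace TubeConfig

variable {ι : Type*} (S : TubeConfig ι)

/-- The number of incidences at points of multiplicity at least `k`. -/
noncomputable def richMass (k : ℕ) : ℕ := ∑ a ∈ S.points with k ≤ S.mult a, S.mult a

lemma sum_mult : ∑ a ∈ S.points, S.mult a = S.J.card * 2 ^ S.e := by
  have h := S.sum_incidence fun _ _ => (1 : ℕ)
  simp only [Finset.sum_const, smul_eq_mul, mul_one, card_heights] at h
  exact h.symm

/-- The weak type bound on each tube, summed over all tubes and rewritten as a sum over points. -/
lemma sum_card_bad_le (H : ℕ) :
    ∑ a ∈ S.points, ((S.tubesAt a).filter fun t => S.Bad (fun b => H ≤ S.mult b) t a.2).card ≤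
      2 * S.richMass H := by
  have h1 := S.sum_incidence fun t a => if S.Bad (fun b => H ≤ S.mult b) t a.2 then 1 else 0
  have h2 := S.sum_incidence fun _ a => if H ≤ S.mult a then 1 else 0
  have h3 : S.richMass H = ∑ a ∈ S.points, ∑ _j ∈ S.tubesAt a, if H ≤ S.mult a then 1 else 0 := by
    rw [richMass, Finset.sum_filter]
    refine Finset.sum_congr rfl fun a _ => ?_
    rw [Finset.sum_const, smul_eq_mul]
    split_ifs <;> simp [mult]
  rw [h3, ← h2, Finset.mul_sum]
  simp only [Finset.card_filter]
  rw [← h1]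
  refine Finset.sum_le_sum fun t _ => ?_
  have := S.card_bad_le (fun b => H ≤ S.mult b) t
  simp only [Finset.card_filter] at this
  convert this using 3
  · congr 1
  · exact Iff.rfl
  · congr

variable {S} in
/-- Concentration of a definite proportion of the incidences of multiplicity about `m`. -/
lemma exists_concentration [Nonempty ι] {M : ℝ} (hM : S.DirSep M) {m H : ℕ}
    (hm : 526338 * M < m) :
    ∃ K : Concentration S m H,
      S.richMass m ≤ 9 * S.richMass H + 526338 * ∑ a ∈ S.points, (K.κ a).card := by
  have hscale : ∀ a, ∃ l : ℕ, ∃ j : ι, (S.tubesAt a).Nonempty → l ≤ S.e + 2 ∧ j ∈ S.tubesAt a ∧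
      S.mult a ≤ 526338 *
        ((S.tubesAt a).filter fun i => ‖S.ω i - S.ω j‖ ≤ 2 ^ l / 2 ^ S.e).card ∧
      (1 ≤ l → ∀ i ∈ S.tubesAt a, 2 * ((S.tubesAt a).filter fun i' =>
        ‖S.ω i' - S.ω i‖ ≤ 64 * (2 ^ l / 2 ^ S.e)).card ≤ S.mult a) := by
    intro a
    by_cases h : (S.tubesAt a).Nonempty
    · obtain ⟨l, hl, j, hj, h1, h2⟩ := exists_concentrated_scale (S.tubesAt a) S.ω S.e h
        fun i hi j hj => S.norm_sub_le_four (S.mem_tubesAt.mp hi).1 (S.mem_tubesAt.mp hj).1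
      exact ⟨l, j, fun _ => ⟨hl, hj, h1, h2⟩⟩
    · exact ⟨0, Classical.arbitrary ι, fun h' => absurd h' h⟩
  choose β ctr hβ using hscale
  -- Points that are not fine have over a quarter of their tubes bad and carry at most `4 * 2 *
  -- richMass H` incidences; with the points of multiplicity at least `H` this makes the factor 9.
  set fine : ℂ × ℤ → Prop := fun a =>
    4 * ((S.tubesAt a).filter fun t => S.Bad (fun b => H ≤ S.mult b) t a.2).card ≤ S.mult a
    with hfine
  set κ : ℂ × ℤ → Finset ι := fun a => (S.tubesAt a).filter fun i =>
    (m ≤ S.mult a ∧ S.mult a < H ∧ fine a) ∧ ‖S.ω i - S.ω (ctr a)‖ ≤ 2 ^ β a / 2 ^ S.e with hκ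
  have hmem : ∀ {a j}, j ∈ κ a → j ∈ S.tubesAt a ∧ (m ≤ S.mult a ∧ S.mult a < H ∧ fine a) ∧
      ‖S.ω j - S.ω (ctr a)‖ ≤ 2 ^ β a / 2 ^ S.e := fun h => Finset.mem_filter.mp h
  have hne : ∀ {a}, (κ a).Nonempty → (S.tubesAt a).Nonempty := fun ⟨j, hj⟩ => ⟨j, (hmem hj).1⟩
  -- At scale 0 the disc has radius `1 / n` and would hold at least `m / 526338 > M` directions,
  -- against separation.
  have hβ1 : ∀ {a}, (κ a).Nonempty → 1 ≤ β a := by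
    intro a h
    by_contra h0
    obtain ⟨j, hj⟩ := h
    obtain ⟨hj1, hj2, -⟩ := hmem hj
    obtain ⟨-, -, h2, -⟩ := hβ a ⟨j, hj1⟩
    rw [show β a = 0 by omega, pow_zero] at h2
    have h3 : ((S.tubesAt a).filter fun i => ‖S.ω i - S.ω (ctr a)‖ ≤ 1 / 2 ^ S.e).card ≤
        (S.J.filter fun i => ‖S.ω i - S.ω (ctr a)‖ ≤ 1 / S.n).card :=
      Finset.card_le_card (Finset.filter_subset_filter _ (Finset.filter_subset _ _))
    have h4 : (((S.tubesAt a).filter fun i => ‖S.ω i - S.ω (ctr a)‖ ≤ 1 / 2 ^ S.e).card : ℝ) ≤ M :=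
      le_trans (Nat.cast_le.mpr h3) (hM _)
    have h5 : (m : ℝ) ≤ 526338 *
        ((S.tubesAt a).filter fun i => ‖S.ω i - S.ω (ctr a)‖ ≤ 1 / 2 ^ S.e).card := by
      exact_mod_cast hj2.1.trans h2
    linarith
  have h2e : (0 : ℝ) < 2 ^ S.e := by positivity
  refine ⟨{ κ := κ, ρ := fun a => 2 ^ β a / 2 ^ S.e, ctr := ctr,
            κ_sub := fun a => Finset.filter_subset _ _
            mult_bounds := fun a ⟨j, hj⟩ => ⟨(hmem hj).2.1.1, (hmem hj).2.1.2.1⟩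
            ctr_mem := fun a h => (hβ a (hne h)).2.1
            κ_near := fun a j hj => (hmem hj).2.2
            two_le := fun a h => ?_
            ρ_le := fun a h => ?_
            many := fun a j hj => ?_ }, ?_⟩
  · unfold n
    rw [mul_div_cancel₀ _ h2e.ne']
    calc (2 : ℝ) = 2 ^ 1 := (pow_one _).symm
      _ ≤ 2 ^ β a := pow_le_pow_right₀ (by norm_num) (hβ1 h)
  · rw [div_le_iff₀ h2e]
    calc (2 : ℝ) ^ β a ≤ 2 ^ (S.e + 2) := pow_le_pow_right₀ (by norm_num) (hβ a (hne h)).1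
      _ = 4 * 2 ^ S.e := by rw [pow_add]; ring
  · have h1 := (hβ a (hne ⟨j, hj⟩)).2.2.2 (hβ1 ⟨j, hj⟩) j (hmem hj).1
    obtain ⟨hm1, -, hf⟩ := (hmem hj).2.1
    simp only [hfine] at hf
    -- At most half of the tubes are close to `j` in direction and at most a quarter are bad, so at
    -- least a quarter remain.
    have hcover : S.tubesAt a ⊆
        ((S.tubesAt a).filter fun i' => ‖S.ω i' - S.ω j‖ ≤ 64 * (2 ^ β a / 2 ^ S.e)) ∪
        (((S.tubesAt a).filter fun t => S.Bad (fun b => H ≤ S.mult b) t a.2) ∪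
        ((S.tubesAt a).filter fun t => 64 * (2 ^ β a / 2 ^ S.e) < ‖S.ω t - S.ω j‖ ∧
          ¬ S.Bad (fun b => H ≤ S.mult b) t a.2)) := by
      intro t ht
      simp only [Finset.mem_union, Finset.mem_filter]
      by_cases hb : S.Bad (fun b => H ≤ S.mult b) t a.2
      · exact Or.inr (Or.inl ⟨ht, hb⟩)
      · rcases le_or_gt ‖S.ω t - S.ω j‖ (64 * (2 ^ β a / 2 ^ S.e)) with h | h
        · exact Or.inl ⟨ht, h⟩
        · exact Or.inr (Or.inr ⟨ht, h, hb⟩)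
    have h2 := (Finset.card_le_card hcover).trans ((Finset.card_union_le _ _).trans
      (add_le_add_right (Finset.card_union_le _ _) _))
    change S.mult a ≤ _ at h2
    omega
  · have hpt : ∀ a ∈ S.points, (if m ≤ S.mult a then S.mult a else 0) ≤
        (if H ≤ S.mult a then S.mult a else 0) +
        (4 * ((S.tubesAt a).filter fun t => S.Bad (fun b => H ≤ S.mult b) t a.2).card +
          526338 * (κ a).card) := by
      intro a ha
      by_cases h1 : m ≤ S.mult a
      · rw [if_pos h1]
        by_cases h2 : H ≤ S.mult a
        · rw [if_pos h2]; omega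
        · rw [if_neg h2]
          by_cases h3 : fine a
          · rcases (S.tubesAt a).eq_empty_or_nonempty with he | hne'
            · have : S.mult a = 0 := by rw [mult, he, Finset.card_empty]
              omega
            · have h4 := (hβ a hne').2.2.1
              have h5 : κ a =
                  (S.tubesAt a).filter fun i => ‖S.ω i - S.ω (ctr a)‖ ≤ 2 ^ β a / 2 ^ S.e :=
                Finset.filter_congr fun i _ => ⟨fun h => h.2, fun h => ⟨⟨h1, not_le.mp h2, h3⟩, h⟩⟩
              rw [h5]
              omega
          · simp only [hfine] at h3
            omega
      · rw [if_neg h1]; exact Nat.zero_le _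
    have hsum := Finset.sum_le_sum hpt
    rw [Finset.sum_add_distrib, Finset.sum_add_distrib, ← Finset.mul_sum, ← Finset.mul_sum,
      ← Finset.sum_filter, ← Finset.sum_filter] at hsum
    have hbad := S.sum_card_bad_le H
    change S.richMass m ≤ S.richMass H + _ at hsum
    change S.richMass m ≤ _ + 526338 * ∑ a ∈ S.points, (κ a).card
    omega

variable {S} in
/-- The mass at a level of quick decay is controlled. -/
lemma mul_richMass_pow_le {M D : ℝ} (hM : S.DirSep M) (hM1 : 1 ≤ M) (hD : S.FatBound D)
    (hD1 : 1 ≤ D) {m : ℕ} (hm : 526338 * M < m) (hF : S.richMass m ≠ 0)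
    (hdecay : 18 * S.richMass (104976 * m) ≤ S.richMass m) :
    (m : ℝ) * (S.richMass m : ℝ) ^ 3 ≤
      (1052676 ^ 4 * 39321600 * 104976 ^ 2) * (D * M * (S.e + 1) * (S.n * S.J.card) ^ 3) := by
  obtain ⟨a, ha, hma⟩ := Finset.exists_ne_zero_of_sum_ne_zero hF
  rw [Finset.mem_filter] at ha
  have hane : (S.tubesAt a).Nonempty := Finset.card_pos.mp (Nat.pos_of_ne_zero hma)
  obtain ⟨j₀, hj₀⟩ := hane
  have hj₀J := (S.mem_tubesAt.mp hj₀).1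
  have : Nonempty ι := ⟨j₀⟩
  obtain ⟨K, hK⟩ := exists_concentration hM (H := 104976 * m) hm
  set F := S.richMass m with hFdef
  -- The decay factor 18 makes `9 * richMass H` at most half of `F`, hence the doubled constant `2 *
  -- 526338`.
  have hKm : (F : ℝ) ≤ 1052676 * K.mass := by
    have : F ≤ 1052676 * ∑ a ∈ S.points, (K.κ a).card := by omega
    rw [K.mass_eq]
    exact_mod_cast this
  have hnpos := S.n_pos
  have hn1 := S.one_le_n
  have hmpos : (0 : ℝ) < m := by linarith
  have hFpos : (0 : ℝ) < F := by exact_mod_cast Nat.pos_of_ne_zero hF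
  have hN : (1 : ℝ) ≤ S.J.card := by exact_mod_cast Finset.card_pos.mpr ⟨j₀, hj₀J⟩
  have he : (0 : ℝ) ≤ S.e := Nat.cast_nonneg _
  set N : ℝ := (S.J.card : ℝ) with hNd
  set X := D * M * (S.e + 1) * (S.n * N) ^ 3 with hX
  by_cases hbig : 4 * N ≤ K.mass
  · have h1 := K.mass_pow_le hM (by linarith) hD (by linarith) hbig ⟨j₀, hj₀J⟩
    have hsupp : (m : ℝ) * K.support.card ≤ F := by
      have : m * K.support.card ≤ F := by
        rw [mul_comm, ← smul_eq_mul]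
        refine (Finset.card_nsmul_le_sum _ (fun a => S.mult a) _ fun a ha => ?_).trans
          (Finset.sum_le_sum_of_subset fun a ha => ?_)
        · exact (K.mult_bounds a (Finset.mem_filter.mp ha).2).1
        · rw [Concentration.support, Finset.mem_filter] at ha
          rw [Finset.mem_filter]
          exact ⟨ha.1, (K.mult_bounds a ha.2).1⟩
      exact_mod_cast this
    have h2 : (m : ℝ) ^ 2 * (m * K.mass ^ 4) ≤
        (m : ℝ) ^ 2 * (39321600 * 104976 ^ 2 * F * X) := by
      calc (m : ℝ) ^ 2 * (m * K.mass ^ 4) = m * (m ^ 2 * K.mass ^ 4) := by ring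
        _ ≤ m * (39321600 * ((104976 * m : ℕ) : ℝ) ^ 2 * K.support.card * D * M * (S.e + 1) *
              (S.n * N) ^ 3) := by gcongr
        _ = (m : ℝ) ^ 2 * (39321600 * 104976 ^ 2 * (m * K.support.card) * X) := by
            rw [hX]; push_cast; ring
        _ ≤ _ := by gcongr
    have h3 := le_of_mul_le_mul_left h2 (by positivity)
    have h4 : (F : ℝ) ^ 4 ≤ 1052676 ^ 4 * K.mass ^ 4 := by
      rw [← mul_pow]
      exact pow_le_pow_left₀ hFpos.le hKm 4
    refine le_of_mul_le_mul_right ?_ hFpos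
    calc (m : ℝ) * (F : ℝ) ^ 3 * F = m * (F : ℝ) ^ 4 := by ring
      _ ≤ m * (1052676 ^ 4 * K.mass ^ 4) := by gcongr
      _ = 1052676 ^ 4 * (m * K.mass ^ 4) := by ring
      _ ≤ 1052676 ^ 4 * (39321600 * 104976 ^ 2 * F * X) := by gcongr
      _ = _ := by ring
  -- With fewer than four relevant heights per tube on average, `F` is at most a constant times `N`.
  -- The trivial bound `m ≤ 289 * n ^ 2 * M`, from packing directions into a disc of radius 4, then
  -- suffices.
  · push Not at hbig
    have hmult : (S.mult a : ℝ) ≤ 289 * S.n ^ 2 * M := by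
      have := card_le_of_local_card_le (S.tubesAt a) S.ω (S.ω j₀) (ρ := 1 / 2 ^ S.e) (B := M)
        (2 ^ (S.e + 2)) (by positivity) (by linarith) (fun j hj => by
          refine (S.norm_sub_le_four (S.mem_tubesAt.mp hj).1 hj₀J).trans (le_of_eq ?_)
          push_cast
          rw [pow_add]; field_simp; norm_num)
        (fun j _ => by
          refine le_trans (Nat.cast_le.mpr (Finset.card_le_card
            (Finset.filter_subset_filter _ (Finset.filter_subset _ _)))) (hM (S.ω j)))
      refine this.trans ?_
      push_cast
      rw [pow_add]
      change (4 * (S.n * 2 ^ 2) + 1) ^ 2 * M ≤ _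
      have h5 : (4 * (S.n * 2 ^ 2) + 1) ^ 2 ≤ 289 * S.n ^ 2 := by nlinarith
      exact mul_le_mul_of_nonneg_right h5 (by linarith)
    have hm' : (m : ℝ) ≤ 289 * S.n ^ 2 * M := le_trans (by exact_mod_cast ha.2) hmult
    have hF' : (F : ℝ) ≤ 4210704 * N := by linarith
    have hDe : 1 ≤ D * (S.e + 1) := by nlinarith
    have hone : 1 ≤ D * (S.e + 1) * S.n := by nlinarith
    calc (m : ℝ) * (F : ℝ) ^ 3 ≤ (289 * S.n ^ 2 * M) * (4210704 * N) ^ 3 := by gcongr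
      _ = 289 * 4210704 ^ 3 * (M * S.n ^ 2 * N ^ 3) := by ring
      _ ≤ (1052676 ^ 4 * 39321600 * 104976 ^ 2) * (M * S.n ^ 2 * N ^ 3) :=
          mul_le_mul_of_nonneg_right (by norm_num) (by positivity)
      _ ≤ (1052676 ^ 4 * 39321600 * 104976 ^ 2) *
          ((M * S.n ^ 2 * N ^ 3) * (D * (S.e + 1) * S.n)) :=
          mul_le_mul_of_nonneg_left (le_mul_of_one_le_right (by positivity) hone) (by norm_num)
      _ = _ := by rw [hX]; ring

end TubeConfig

/-! ### The overlap bound for discretized tubes -/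

/-- Direction-separated tubes have almost disjoint discretizations, if fat tubes contain few of
the points. -/
theorem exists_card_tubes_le : ∃ C : ℝ, 1 ≤ C ∧ ∀ {ι : Type*} (S : TubeConfig ι) {M D : ℝ},
    S.DirSep M → 1 ≤ M → S.FatBound D → 1 ≤ D →
      S.J.card * S.n ≤ C * (M * D * (S.e + 1) * S.points.card) := by
  refine ⟨16 * (1052676 ^ 4 * 39321600 * 104976 ^ 2), by norm_num, ?_⟩
  intro ι S M D hM hM1 hD hD1
  set c : ℝ := 1052676 ^ 4 * 39321600 * 104976 ^ 2 with hc
  have hc1 : 1052676 ≤ c := by rw [hc]; norm_num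
  have hnpos := S.n_pos
  have he : (0 : ℝ) ≤ S.e := Nat.cast_nonneg _
  rcases S.J.eq_empty_or_nonempty with hJ | hJ
  · rw [hJ, Finset.card_empty, Nat.cast_zero, zero_mul]; positivity
  have hN : (0 : ℝ) < S.J.card := by exact_mod_cast hJ.card_pos
  set N : ℝ := (S.J.card : ℝ) with hNd
  have hQ : (0 : ℝ) < S.points.card := by
    obtain ⟨j, hj⟩ := hJ
    have hs : S.σ j ∈ S.heights j := by
      rw [TubeConfig.heights, Finset.mem_Ico]; constructor
      · exact le_rfl
      · have : (0 : ℤ) < 2 ^ S.e := by positivity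
        linarith
    exact_mod_cast Finset.card_pos.mpr ⟨_, S.pt_mem_points hj hs⟩
  set Q : ℝ := (S.points.card : ℝ) with hQd
  -- Half the average multiplicity, rounded up: points below it carry at most half of the
  -- incidences.
  set m₀ : ℕ := ⌈N * S.n / (2 * Q)⌉₊ with hm₀
  have hm₀pos : 0 < m₀ := Nat.ceil_pos.mpr (by positivity)
  have hceil : N * S.n ≤ 2 * Q * m₀ := by
    have := Nat.le_ceil (N * S.n / (2 * Q))
    rw [div_le_iff₀ (by positivity)] at this
    linarith
  suffices h : (m₀ : ℝ) ≤ 8 * c * (M * D * (S.e + 1)) by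
    calc N * S.n ≤ 2 * Q * m₀ := hceil
      _ ≤ 2 * Q * (8 * c * (M * D * (S.e + 1))) := by gcongr
      _ = _ := by ring
  have hMDe : M ≤ M * D * (S.e + 1) := by
    have : 1 ≤ D * (S.e + 1) := by nlinarith
    nlinarith
  by_cases hsmall : (m₀ : ℝ) ≤ 526338 * M
  · refine hsmall.trans ?_
    have : 526338 * M ≤ c * M := by nlinarith
    nlinarith
  push Not at hsmall
  have hlow : N * S.n ≤ 2 * S.richMass m₀ := by
    have h1 := Finset.sum_filter_add_sum_filter_not S.points (fun a => m₀ ≤ S.mult a) S.mult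
    rw [S.sum_mult] at h1
    have h2 : ((∑ a ∈ S.points with ¬ m₀ ≤ S.mult a, S.mult a : ℕ) : ℝ) ≤ N * S.n / 2 := by
      push_cast
      have h3 : ∀ a ∈ S.points.filter (fun a => ¬ m₀ ≤ S.mult a),
          (S.mult a : ℝ) ≤ N * S.n / (2 * Q) := by
        intro a ha
        have := (Finset.mem_filter.mp ha).2
        rw [not_le, hm₀, Nat.lt_ceil] at this
        exact this.le
      refine (Finset.sum_le_card_nsmul _ _ _ h3).trans ?_
      rw [nsmul_eq_mul]
      have h4 : ((S.points.filter (fun a => ¬ m₀ ≤ S.mult a)).card : ℝ) ≤ Q :=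
        Nat.cast_le.mpr (Finset.card_filter_le _ _)
      calc _ ≤ Q * (N * S.n / (2 * Q)) := by gcongr
        _ = N * S.n / 2 := by field_simp
    have h5 : (S.richMass m₀ : ℝ) + (∑ a ∈ S.points with ¬ m₀ ≤ S.mult a, S.mult a : ℕ) =
        N * S.n := by
      have h1' : S.richMass m₀ + (∑ a ∈ S.points with ¬ m₀ ≤ S.mult a, S.mult a) =
          S.J.card * 2 ^ S.e := h1
      unfold TubeConfig.n
      rw [hNd]
      exact_mod_cast h1'
    linarith
  have hNn : 0 < N * S.n := by positivity
  have hF₀ : S.richMass m₀ ≠ 0 := by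
    intro h0
    rw [h0, Nat.cast_zero] at hlow
    linarith
  obtain ⟨m, hmm, hFm, hdecay, hcube⟩ := exists_level S.richMass (m₀ := m₀) (B := S.J.card)
    (fun k hk => Finset.sum_eq_zero fun a ha => by
      have h1 := (Finset.mem_filter.mp ha).2
      have h2 : S.mult a ≤ S.J.card := Finset.card_filter_le _ _
      omega) hF₀ hm₀pos
  have hmm' : (m₀ : ℝ) ≤ m := by exact_mod_cast hmm
  have hkey := TubeConfig.mul_richMass_pow_le hM hM1 hD hD1 (hsmall.trans_le hmm') hFm hdecay
  have hcube' : (m₀ : ℝ) * (S.richMass m₀ : ℝ) ^ 3 ≤ m * (S.richMass m : ℝ) ^ 3 := by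
    exact_mod_cast hcube
  have hNn3 : 0 < (N * S.n) ^ 3 := by positivity
  refine le_of_mul_le_mul_right ?_ hNn3
  have h6 : (N * S.n) ^ 3 ≤ 8 * (S.richMass m₀ : ℝ) ^ 3 := by
    calc (N * S.n) ^ 3 ≤ (2 * (S.richMass m₀ : ℝ)) ^ 3 := pow_le_pow_left₀ hNn.le hlow 3
      _ = _ := by ring
  calc (m₀ : ℝ) * (N * S.n) ^ 3 ≤ m₀ * (8 * (S.richMass m₀ : ℝ) ^ 3) := by gcongr
    _ = 8 * (m₀ * (S.richMass m₀ : ℝ) ^ 3) := by ring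
    _ ≤ 8 * (c * (D * M * (S.e + 1) * (S.n * N) ^ 3)) := by
        have := hcube'.trans hkey
        linarith
    _ = 8 * c * (M * D * (S.e + 1)) * (N * S.n) ^ 3 := by ring

end TubeCombinatorics

/-! ### From tubes in space to discretized tubes -/

section TubeGeometry

open scoped Classical

/-- The slope of the normal direction at a point of the paraboloid. -/
noncomputable def normalSlope (c : R3) : ℂ := ⟨-2 * c 0, -2 * c 1⟩

/-- The point of three-space over a point of the plane at a given height. -/
noncomputable def lift (z : ℂ) (h : ℝ) : R3 := !₂[z.re, z.im, h]

lemma norm_sq_r3 (x : R3) : ‖x‖ ^ 2 = x 0 ^ 2 + x 1 ^ 2 + x 2 ^ 2 := by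
  rw [EuclideanSpace.norm_sq_eq, Fin.sum_univ_three]
  simp only [Real.norm_eq_abs, sq_abs]

lemma dist_lift_sq (z w : ℂ) (h k : ℝ) :
    dist (lift z h) (lift w k) ^ 2 = ‖z - w‖ ^ 2 + (h - k) ^ 2 := by
  rw [dist_eq_norm, norm_sq_r3, ← Complex.normSq_eq_norm_sq, Complex.normSq_apply]
  simp [lift]
  ring

lemma dist_lift_le (z w : ℂ) (h k : ℝ) :
    dist (lift z h) (lift w k) ≤ ‖z - w‖ + |h - k| := by
  refine abs_le_of_sq_le_sq' ?_ (by positivity) |>.2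
  rw [dist_lift_sq, add_sq, sq_abs]
  have : 0 ≤ 2 * ‖z - w‖ * |h - k| := by positivity
  linarith

lemma norm_normalSlope_le {c : R3} (hc : c ∈ paraboloid) : ‖normalSlope c‖ ≤ 2 := by
  refine abs_le_of_sq_le_sq' ?_ (by norm_num) |>.2
  rw [← Complex.normSq_eq_norm_sq, Complex.normSq_apply]
  simp only [normalSlope]
  have := hc.2
  nlinarith

/-- The tube contains the balls of radius `1 / 2` about the points of its axis which are not too
close to its ends. -/
lemma IsTube.exists_axis {v : R3} {L : ℝ} {T : Set R3} (hT : IsTube v L T) :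
    ∃ p : R3, ∀ a : ℝ, |a| ≤ (L - 1) / 2 → Metric.closedBall (p + a • v) (1 / 2) ⊆ T := by
  obtain ⟨p, e₁, e₂, ho, rfl⟩ := hT
  refine ⟨p, fun a ha y hy => ?_⟩
  rw [Metric.mem_closedBall, dist_eq_norm] at hy
  have n1 : ‖e₁‖ = 1 := ho.1 0
  have n2 : ‖e₂‖ = 1 := ho.1 1
  have n3 : ‖v‖ = 1 := ho.1 2
  have o1 : inner ℝ e₁ v = 0 := ho.2 (show (0 : Fin 3) ≠ 2 by decide)
  have o2 : inner ℝ e₂ v = 0 := ho.2 (show (1 : Fin 3) ≠ 2 by decide)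
  have hdec : y - p = a • v + (y - (p + a • v)) := by abel
  have key : ∀ u : R3, ‖u‖ = 1 → |inner ℝ u (y - (p + a • v))| ≤ 1 / 2 := fun u hu => by
    refine (abs_real_inner_le_norm _ _).trans ?_
    rw [hu, one_mul]; exact hy
  refine ⟨?_, ?_, ?_⟩
  · rw [hdec, inner_add_right, inner_smul_right, o1, mul_zero, zero_add]; exact key _ n1
  · rw [hdec, inner_add_right, inner_smul_right, o2, mul_zero, zero_add]; exact key _ n2
  · rw [hdec, inner_add_right, inner_smul_right, real_inner_self_eq_norm_sq, n3, one_pow, mul_one]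
    refine (abs_add_le _ _).trans ?_
    linarith [key _ n3]

/-- A normal tube of the paraboloid in the coordinates of a line over the vertical axis. -/
lemma IsTube.exists_line {c : R3} (hc : c ∈ paraboloid) {L : ℝ} {T : Set R3}
    (hT : IsTube (unitNormal c) L T) :
    ∃ (z : ℂ) (t : ℝ), ∀ h : ℝ, |h - t| ≤ (L - 1) / 5 →
      Metric.closedBall (lift (z + h * normalSlope c) h) (1 / 2) ⊆ T := by
  obtain ⟨p, hp⟩ := hT.exists_axis
  refine ⟨⟨p 0 + 2 * p 2 * c 0, p 1 + 2 * p 2 * c 1⟩, p 2, fun h hh => ?_⟩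
  set ν := Real.sqrt (4 * c 0 ^ 2 + 4 * c 1 ^ 2 + 1) with hν
  have hνpos : 0 < ν := Real.sqrt_pos.mpr (by positivity)
  -- A unit of height is `ν` units of length along the axis, so heights within `(L - 1) / 5` stay
  -- within `(L - 1) / 2` of the centre.
  have hν5 : ν ≤ 5 / 2 := by
    rw [hν, Real.sqrt_le_left (by norm_num)]
    have := hc.2
    linarith
  have hlift : lift ((⟨p 0 + 2 * p 2 * c 0, p 1 + 2 * p 2 * c 1⟩ : ℂ) + h * normalSlope c) h =
      p + ((p 2 - h) * ν) • unitNormal c := by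
    ext i
    rw [unitNormal, ← hν, smul_smul, mul_inv_cancel_right₀ hνpos.ne']
    fin_cases i
    · simp [lift, normalSlope]; ring
    · simp [lift, normalSlope]; ring
    · simp [lift]
  rw [hlift]
  refine hp _ ?_
  rw [abs_mul, abs_of_pos hνpos, abs_sub_comm]
  calc |h - p 2| * ν ≤ (L - 1) / 5 * (5 / 2) :=
        mul_le_mul hh hν5 hνpos.le ((abs_nonneg _).trans hh)
    _ = (L - 1) / 2 := by ring

/-- The nearest point in the lattice of Gaussian integers divided by four. -/
noncomputable def latticePoint (z : ℂ) : ℂ := ⟨round (4 * z.re) / 4, round (4 * z.im) / 4⟩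

lemma norm_latticePoint_sub_le (z : ℂ) : ‖latticePoint z - z‖ ≤ 1 / 4 := by
  refine (Complex.norm_le_abs_re_add_abs_im _).trans ?_
  have h1 := abs_le.mp (abs_sub_round (4 * z.re))
  have h2 := abs_le.mp (abs_sub_round (4 * z.im))
  have h3 : |(latticePoint z - z).re| ≤ 1 / 8 := by
    simp only [latticePoint, Complex.sub_re]
    rw [abs_le]; constructor <;> linarith [h1.1, h1.2]
  have h4 : |(latticePoint z - z).im| ≤ 1 / 8 := by
    simp only [latticePoint, Complex.sub_im]
    rw [abs_le]; constructor <;> linarith [h2.1, h2.2]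
  linarith

lemma quarter_le_norm_latticePoint_sub {z w : ℂ} (h : latticePoint z ≠ latticePoint w) :
    1 / 4 ≤ ‖latticePoint z - latticePoint w‖ := by
  have key : ∀ a b : ℤ, a ≠ b → 1 / 4 ≤ |(a : ℝ) / 4 - b / 4| := by
    intro a b hab
    have h1 : (1 : ℝ) ≤ |(a : ℝ) - b| := by
      exact_mod_cast Int.one_le_abs (sub_ne_zero.mpr hab)
    rw [← sub_div, abs_div, abs_of_pos (show (0 : ℝ) < 4 by norm_num)]
    linarith
  by_cases hre : round (4 * z.re) = round (4 * w.re)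
  · by_cases him : round (4 * z.im) = round (4 * w.im)
    · exact absurd (by rw [latticePoint, latticePoint, hre, him]) h
    · exact (key _ _ him).trans (Complex.abs_im_le_norm (latticePoint z - latticePoint w))
  · exact (key _ _ hre).trans (Complex.abs_re_le_norm (latticePoint z - latticePoint w))

/-- The volume of the ball of radius `1 / 8`. -/
noncomputable def smallVolume : ℝ := (volume (Metric.ball (0 : R3) (1 / 8))).toReal

lemma smallVolume_pos : 0 < smallVolume :=
  ENNReal.toReal_pos (Metric.measure_ball_pos _ _ (by norm_num)).ne' measure_ball_lt_top.ne

/-- Packing bound for separated points whose neighbourhoods lie in a set of dimension `α`. -/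
lemma HasDimension.card_le {C α : ℝ} {Ω : Set R3} (hΩ : HasDimension C α Ω)
    (hα₃ : α ≤ 3) {β : Type*} (P : Finset β) (f : β → R3)
    (hf : ∀ a ∈ P, Metric.ball (f a) (1 / 8) ⊆ Ω)
    (hsep : ∀ a ∈ P, ∀ b ∈ P, a ≠ b → 1 / 4 ≤ dist (f a) (f b)) {x : R3} {R : ℝ} (hR : 1 ≤ R)
    (hx : ∀ a ∈ P, dist (f a) x ≤ R) :
    (P.card : ℝ) ≤ 8 * |C| / smallVolume * R ^ α := by
  have h1 : volume (⋃ a ∈ P, Metric.ball (f a) (1 / 8)) =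
      P.card * volume (Metric.ball (0 : R3) (1 / 8)) := by
    rw [measure_biUnion_finset]
    · rw [Finset.sum_congr rfl fun a _ => Measure.addHaar_ball_center volume (f a) (1 / 8),
        Finset.sum_const, nsmul_eq_mul]
    · intro a ha b hb hab
      exact Metric.ball_disjoint_ball (by linarith [hsep a ha b hb hab])
    · exact fun a _ => measurableSet_ball
  have h2 : (⋃ a ∈ P, Metric.ball (f a) (1 / 8)) ⊆ Ω ∩ Metric.closedBall x (2 * R) := by
    refine Set.iUnion₂_subset fun a ha y hy => ⟨hf a ha hy, ?_⟩
    rw [Metric.mem_ball] at hy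
    rw [Metric.mem_closedBall]
    linarith [dist_triangle y (f a) x, hx a ha]
  have h3 := (measure_mono h2).trans (hΩ x (2 * R) (by linarith))
  rw [h1] at h3
  have hR0 : 0 < R := by linarith
  have hle : C * (2 * R) ^ α ≤ 8 * |C| * R ^ α := by
    rw [Real.mul_rpow (by norm_num) hR0.le]
    have h4 : (2 : ℝ) ^ α ≤ 8 := by
      calc (2 : ℝ) ^ α ≤ 2 ^ (3 : ℝ) := Real.rpow_le_rpow_of_exponent_le (by norm_num) hα₃
        _ = 8 := by norm_num
    have h5 : 0 ≤ R ^ α := Real.rpow_nonneg hR0.le _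
    have h6 : 0 ≤ (2 : ℝ) ^ α := by positivity
    calc C * (2 ^ α * R ^ α) ≤ |C| * (8 * R ^ α) := by
          refine mul_le_mul (le_abs_self C) ?_ (by positivity) (abs_nonneg C)
          gcongr
      _ = _ := by ring
  have h7 := ENNReal.toReal_mono ENNReal.ofReal_ne_top
    (h3.trans (ENNReal.ofReal_le_ofReal hle))
  rw [ENNReal.toReal_mul, ENNReal.toReal_natCast,
    ENNReal.toReal_ofReal (by have := Real.rpow_nonneg hR0.le α; positivity)] at h7
  change (P.card : ℝ) * smallVolume ≤ _ at h7
  rw [div_mul_eq_mul_div, le_div_iff₀ smallVolume_pos]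
  exact h7

/-! ### Separation of the normal directions -/

namespace IsCapDecomposition

variable {ι : Type*} {L : ℝ} {M : ℕ} {c : ι → R3}

/-- Few centers of caps have slopes near a given one. -/
lemma card_le_of_near (h : IsCapDecomposition L M c) (hL : 0 < L) (s : Finset ι) (j : ι)
    (hs : ∀ i ∈ s, ‖normalSlope (c i) - normalSlope (c j)‖ ≤ 2 / (5 * L)) : s.card ≤ M := by
  -- Slopes within `2 δ`, where `δ = 1 / (5 L)`, put the centers within `δ`, `δ`, `4 δ` in the
  -- coordinates, hence within `5 δ = L⁻¹`. All these caps then contain `c j`.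
  have hsub : (s : Set ι) ⊆ {i | c j ∈ paraboloidCap (c i) L⁻¹} := by
    intro i hi
    refine ⟨h.center_mem j, ?_⟩
    have hn := hs i hi
    have h0 := (Complex.abs_re_le_norm _).trans hn
    have h1 := (Complex.abs_im_le_norm _).trans hn
    simp only [normalSlope, Complex.sub_re, Complex.sub_im] at h0 h1
    set δ := 1 / (5 * L) with hδ
    have h2δ : 2 / (5 * L) = 2 * δ := by rw [hδ]; ring
    have hδL : L⁻¹ = 5 * δ := by rw [hδ]; field_simp
    have hδpos : 0 < δ := by positivity
    rw [h2δ, abs_le] at h0 h1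
    rw [Metric.mem_closedBall, hδL, dist_eq_norm]
    refine abs_le_of_sq_le_sq' ?_ (by positivity) |>.2
    rw [norm_sq_r3]
    simp only [PiLp.sub_apply]
    obtain ⟨hi1, hi2⟩ := h.center_mem i
    obtain ⟨hj1, hj2⟩ := h.center_mem j
    rw [hi1, hj1]
    set x := c i 0
    set y := c i 1
    set x' := c j 0
    set y' := c j 1
    have bound : ∀ a b : ℝ, a ^ 2 + b ^ 2 ≤ 1 → |a| ≤ 1 := fun a b hab =>
      abs_le_one_iff_mul_self_le_one.mpr (by nlinarith [sq_nonneg b])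
    have b1 := abs_le.mp (bound x y hi2)
    have b2 := abs_le.mp (bound y x (by linarith))
    have b3 := abs_le.mp (bound x' y' hj2)
    have b4 := abs_le.mp (bound y' x' (by linarith))
    have d1 : |x' - x| ≤ δ := by rw [abs_le]; constructor <;> linarith [h0.1, h0.2]
    have d2 : |y' - y| ≤ δ := by rw [abs_le]; constructor <;> linarith [h1.1, h1.2]
    have d3 : |x' ^ 2 + y' ^ 2 - (x ^ 2 + y ^ 2)| ≤ 4 * δ := by
      have heq : x' ^ 2 + y' ^ 2 - (x ^ 2 + y ^ 2) = (x' - x) * (x' + x) + (y' - y) * (y' + y) := by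
        ring
      rw [heq]
      refine (abs_add_le _ _).trans ?_
      rw [abs_mul, abs_mul]
      have s1 : |x' + x| ≤ 2 := by rw [abs_le]; constructor <;> linarith [b1.1, b1.2, b3.1, b3.2]
      have s2 : |y' + y| ≤ 2 := by rw [abs_le]; constructor <;> linarith [b2.1, b2.2, b4.1, b4.2]
      have := mul_le_mul d1 s1 (abs_nonneg _) hδpos.le
      have := mul_le_mul d2 s2 (abs_nonneg _) hδpos.le
      linarith
    have e1 : (x' - x) ^ 2 ≤ δ ^ 2 := sq_le_sq' (abs_le.mp d1).1 (abs_le.mp d1).2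
    have e2 : (y' - y) ^ 2 ≤ δ ^ 2 := sq_le_sq' (abs_le.mp d2).1 (abs_le.mp d2).2
    have e3 : (x' ^ 2 + y' ^ 2 - (x ^ 2 + y ^ 2)) ^ 2 ≤ (4 * δ) ^ 2 :=
      sq_le_sq' (abs_le.mp d3).1 (abs_le.mp d3).2
    nlinarith [sq_nonneg δ]
  have := (Set.encard_le_encard hsub).trans (h.overlap (c j))
  rw [Set.encard_coe_eq_coe_finsetCard] at this
  exact_mod_cast this

lemma card_le_of_subset_disc (h : IsCapDecomposition L M c) (hL : 0 < L) (s : Finset ι) (z : ℂ)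
    (K : ℕ) (hs : ∀ j ∈ s, ‖normalSlope (c j) - z‖ ≤ K * (2 / (5 * L))) :
    (s.card : ℝ) ≤ (4 * K + 1) ^ 2 * M :=
  card_le_of_local_card_le s (fun j => normalSlope (c j)) z K (by positivity) (by positivity) hs
    fun j _ => Nat.cast_le.mpr (h.card_le_of_near hL _ j fun _ hi => (Finset.mem_filter.mp hi).2)

/-- The number of caps is at most a constant times `L ^ 2`. -/
lemma card_le (h : IsCapDecomposition L M c) (hL : 2 ≤ L) (s : Finset ι) :
    (s.card : ℝ) ≤ 529 * L ^ 2 * M := by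
  have hK : 5 * L ≤ ⌈5 * L⌉₊ := Nat.le_ceil _
  have hK' : (⌈5 * L⌉₊ : ℝ) < 5 * L + 1 := Nat.ceil_lt_add_one (by linarith)
  refine (h.card_le_of_subset_disc (by linarith) s 0 ⌈5 * L⌉₊ fun j _ => ?_).trans ?_
  · rw [sub_zero]
    refine (norm_normalSlope_le (h.center_mem j)).trans ?_
    calc (2 : ℝ) = 5 * L * (2 / (5 * L)) := by field_simp
      _ ≤ _ := by gcongr
  · have : (4 * (⌈5 * L⌉₊ : ℝ) + 1) ^ 2 ≤ 529 * L ^ 2 := by nlinarith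
    exact mul_le_mul_of_nonneg_right this (Nat.cast_nonneg M)

lemma finite (h : IsCapDecomposition L M c) (hL : 2 ≤ L) : Finite ι := by
  by_contra hinf
  rw [not_finite_iff_infinite] at hinf
  obtain ⟨s, hs⟩ := Infinite.exists_subset_card_eq ι (⌈529 * L ^ 2 * M⌉₊ + 1)
  have h1 := h.card_le hL s
  rw [hs] at h1
  have h2 := Nat.le_ceil (529 * L ^ 2 * M)
  push_cast at h1
  linarith

end IsCapDecomposition

/-! ### Discretization and the fat tube bound -/

/-- Discretization of the tubes in `Ω`. -/
lemma exists_tubeConfig {ι : Type*} {L : ℝ} (hL : 6 ≤ L) {M : ℕ} {c : ι → R3}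
    {F : ι → Set (Set R3)} (Ω : Set R3) (hc : IsCapDecomposition L M c)
    (hF : ∀ j, IsTubeTiling (unitNormal (c j)) L (F j)) (J : Finset ι)
    (hJ : ∀ j ∈ J, j ∈ tubeDirections L F Ω) :
    ∃ S : TubeConfig ι, S.J = J ∧ (∀ j, S.ω j = normalSlope (c j)) ∧ S.n ≤ L ∧ L ≤ 20 * S.n ∧
      (∀ a ∈ S.points, Metric.ball (lift a.1 a.2) (1 / 8) ⊆ Ω ∧ dist (lift a.1 a.2) 0 ≤ 5 * L) ∧
      ∀ a ∈ S.points, ∀ b ∈ S.points, a ≠ b → 1 / 4 ≤ dist (lift a.1 a.2) (lift b.1 b.2) := by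
  -- Heights from `⌈t j⌉` to `⌈t j⌉ + 2 ^ e - 1` stay within `2 ^ e ≤ (L - 1) / 5` of `t j`; `6 ≤ L`
  -- makes room for `e = 0`.
  obtain ⟨e, he1, he2⟩ := exists_nat_pow_near (show 1 ≤ (L - 1) / 5 by linarith)
    (show (1 : ℝ) < 2 by norm_num)
  have hline : ∀ j, ∃ (z : ℂ) (t : ℝ), j ∈ J → ∀ h : ℝ, |h - t| ≤ (L - 1) / 5 →
      Metric.closedBall (lift (z + h * normalSlope (c j)) h) (1 / 2) ⊆
        Ω ∩ Metric.closedBall 0 (5 * L) := by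
    intro j
    by_cases hj : j ∈ J
    · obtain ⟨T, hT, hTΩ⟩ := hJ j hj
      obtain ⟨z, t, h⟩ := ((hF j).isTube T hT).exists_line (hc.center_mem j)
      exact ⟨z, t, fun _ h' hh' => (h h' hh').trans hTΩ⟩
    · exact ⟨0, 0, fun h => absurd h hj⟩
  choose z t hzt using hline
  let S : TubeConfig ι :=
    { J := J, e := e, ω := fun j => normalSlope (c j), p := z, σ := fun j => ⌈t j⌉
      c := fun j s => latticePoint (z j + s * normalSlope (c j))
      norm_ω_le := fun j _ => norm_normalSlope_le (hc.center_mem j)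
      near := fun j _ s _ => norm_latticePoint_sub_le _ }
  have hpoint : ∀ a ∈ S.points, ∃ w : ℂ, a.1 = latticePoint w ∧
      Metric.ball (lift a.1 a.2) (1 / 8) ⊆ Ω ∩ Metric.closedBall 0 (5 * L) := by
    intro a ha
    simp only [TubeConfig.points, Finset.mem_biUnion, Finset.mem_image] at ha
    obtain ⟨j, hj, s, hs, rfl⟩ := ha
    refine ⟨_, rfl, ?_⟩
    rw [TubeConfig.heights, Finset.mem_Ico] at hs
    change ⌈t j⌉ ≤ s ∧ s < ⌈t j⌉ + 2 ^ e at hs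
    have h1 : t j ≤ s := Int.ceil_le.mp hs.1
    have h2 : (s : ℝ) ≤ t j + 2 ^ e := by
      have h3 : (s : ℝ) + 1 ≤ ⌈t j⌉ + 2 ^ e := by exact_mod_cast hs.2
      linarith [Int.ceil_lt_add_one (t j)]
    have hball := hzt j hj s (by rw [abs_le]; constructor <;> linarith)
    refine subset_trans ?_ hball
    -- Rounding moves the center by at most `1 / 4`, and `1 / 4 + 1 / 8 ≤ 1 / 2`.
    refine subset_trans Metric.ball_subset_closedBall (Metric.closedBall_subset_closedBall' ?_)
    have h4 := dist_lift_le (latticePoint (z j + s * normalSlope (c j)))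
      (z j + ((s : ℝ) : ℂ) * normalSlope (c j)) s s
    rw [sub_self, abs_zero, add_zero, Complex.ofReal_intCast] at h4
    have h5 := norm_latticePoint_sub_le (z j + s * normalSlope (c j))
    change 1 / 8 + dist (lift (latticePoint (z j + s * normalSlope (c j))) s)
      (lift (z j + ((s : ℝ) : ℂ) * normalSlope (c j)) s) ≤ 1 / 2
    rw [Complex.ofReal_intCast]
    linarith
  refine ⟨S, rfl, fun _ => rfl, ?_, ?_, fun a ha => ?_, fun a ha b hb hab => ?_⟩
  · change (2 : ℝ) ^ e ≤ L
    linarith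
  · change L ≤ 20 * (2 : ℝ) ^ e
    rw [pow_succ] at he2
    linarith
  · obtain ⟨w, -, h⟩ := hpoint a ha
    exact ⟨fun y hy => (h hy).1, (h (Metric.mem_ball_self (by norm_num))).2⟩
  · obtain ⟨w, hw, -⟩ := hpoint a ha
    obtain ⟨w', hw', -⟩ := hpoint b hb
    refine abs_le_of_sq_le_sq' ?_ dist_nonneg |>.2
    rw [dist_lift_sq]
    by_cases h : a.1 = b.1
    · have h2 : a.2 ≠ b.2 := fun h2 => hab (Prod.ext h h2)
      have h3 : (1 : ℝ) ≤ |(a.2 : ℝ) - b.2| := by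
        exact_mod_cast Int.one_le_abs (sub_ne_zero.mpr h2)
      have h4 : (1 : ℝ) ≤ ((a.2 : ℝ) - b.2) ^ 2 := by rw [← sq_abs]; nlinarith
      nlinarith [sq_nonneg ‖a.1 - b.1‖]
    · rw [hw, hw'] at h
      have h3 := quarter_le_norm_latticePoint_sub h
      rw [← hw, ← hw'] at h3
      nlinarith [sq_nonneg ((a.2 : ℝ) - b.2)]

/-- The factor `r ^ 2` is what the fat tube count needs, since there are about `n / r` balls. The
excess `r ^ (α - 2)` is at most 1 or `(4 L) ^ (α - 2)`. -/
lemma rpow_le_sq_mul_max {α L r : ℝ} (hα₃ : α ≤ 3) (hL : 1 ≤ L) (hr : 1 ≤ r) (hrL : r ≤ 4 * L) :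
    r ^ α ≤ 4 * max 1 (L ^ (α - 2)) * r ^ 2 := by
  have hr0 : 0 < r := by linarith
  rcases le_total α 2 with h | h
  · have h1 : r ^ α ≤ r ^ 2 := by
      rw [← Real.rpow_natCast]
      exact Real.rpow_le_rpow_of_exponent_le hr (by exact_mod_cast h)
    have h2 : 1 ≤ max 1 (L ^ (α - 2)) := le_max_left _ _
    nlinarith [sq_nonneg r]
  · have h1 : r ^ α = r ^ (α - 2) * r ^ 2 := by
      rw [← Real.rpow_natCast, ← Real.rpow_add hr0]
      congr 1; push_cast; ring
    have h2 : r ^ (α - 2) ≤ 4 * L ^ (α - 2) := by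
      calc r ^ (α - 2) ≤ (4 * L) ^ (α - 2) := Real.rpow_le_rpow hr0.le hrL (by linarith)
        _ = 4 ^ (α - 2) * L ^ (α - 2) := Real.mul_rpow (by norm_num) (by linarith)
        _ ≤ 4 * L ^ (α - 2) := by
            have : (4 : ℝ) ^ (α - 2) ≤ 4 ^ (1 : ℝ) :=
              Real.rpow_le_rpow_of_exponent_le (by norm_num) (by linarith)
            rw [Real.rpow_one] at this
            have h3 : 0 ≤ L ^ (α - 2) := Real.rpow_nonneg (by linarith) _
            gcongr
    rw [h1]
    have h4 : L ^ (α - 2) ≤ max 1 (L ^ (α - 2)) := le_max_right _ _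
    have : r ^ (α - 2) ≤ 4 * max 1 (L ^ (α - 2)) := by linarith
    gcongr

/-- Fat tubes contain few points of a discretized set of dimension `α`. -/
lemma TubeConfig.fatBound_of_dimension {ι : Type*} (S : TubeConfig ι) {L α B : ℝ} (hL : 1 ≤ L)
    (hα₃ : α ≤ 3) (hB : 0 ≤ B) (hn : S.n ≤ L) (hn' : L ≤ 20 * S.n)
    (hdim : ∀ P ⊆ S.points, ∀ (x : R3) (R : ℝ), 1 ≤ R →
      (∀ a ∈ P, dist (lift a.1 a.2) x ≤ R) → (P.card : ℝ) ≤ B * R ^ α)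
    (hheight : ∀ a ∈ S.points, |(a.2 : ℝ)| ≤ 5 * L) :
    S.FatBound (7074720 * B * max 1 (L ^ (α - 2))) := by
  intro z v r hv hr hrn
  have hr0 : 0 < r := by linarith
  have hnpos := S.n_pos
  set P := S.points.filter fun a => ‖a.1 - (z + a.2 * v)‖ ≤ 7 * r with hP
  -- The fat tube is cut into slabs of height `r`, each within `17 r` of any of its points. The
  -- constant `7074720` is `360 * 17 ^ 3 * 4`.
  set T := Finset.Icc ⌊-(5 * L / r)⌋ ⌊5 * L / r⌋ with hT
  have hmaps : ∀ a ∈ P, ⌊(a.2 : ℝ) / r⌋ ∈ T := by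
    intro a ha
    have h1 := abs_le.mp (hheight a (Finset.mem_filter.mp ha).1)
    rw [hT, Finset.mem_Icc]
    constructor
    · refine Int.floor_le_floor ?_
      rw [← neg_div]
      gcongr
      exact h1.1
    · refine Int.floor_le_floor ?_
      gcongr
      exact h1.2
  have hTcard : (T.card : ℝ) ≤ 360 * S.n / r := by
    have h1 : ⌊-(5 * L / r)⌋ ≤ ⌊5 * L / r⌋ := by
      refine Int.floor_le_floor ?_
      have : 0 ≤ 5 * L / r := by positivity
      linarith
    have h2 : (T.card : ℤ) = ⌊5 * L / r⌋ + 1 - ⌊-(5 * L / r)⌋ := by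
      rw [hT, Int.card_Icc, Int.toNat_of_nonneg (by omega)]
    have h3 : (T.card : ℝ) = ⌊5 * L / r⌋ + 1 - ⌊-(5 * L / r)⌋ := by exact_mod_cast h2
    have h4 := Int.floor_le (5 * L / r)
    have h5 := Int.lt_floor_add_one (-(5 * L / r))
    have h6 : (T.card : ℝ) ≤ 2 * (5 * L / r) + 2 := by linarith
    refine h6.trans ?_
    have h7 : 2 * (5 * L / r) + 2 = (10 * L + 2 * r) / r := by field_simp; ring
    rw [h7]
    gcongr
    linarith
  have hfib : ∀ k ∈ T, ((P.filter fun a => ⌊(a.2 : ℝ) / r⌋ = k).card : ℝ) ≤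
      B * (4913 * (4 * max 1 (L ^ (α - 2)) * r ^ 2)) := by
    intro k _
    rcases (P.filter fun a => ⌊(a.2 : ℝ) / r⌋ = k).eq_empty_or_nonempty with h | ⟨b, hb⟩
    · rw [h]; simp only [Finset.card_empty, Nat.cast_zero]; positivity
    · rw [Finset.mem_filter, hP, Finset.mem_filter] at hb
      refine (hdim _ ((Finset.filter_subset _ _).trans (Finset.filter_subset _ _))
        (lift b.1 b.2) (17 * r) (by linarith) fun a ha => ?_).trans ?_
      · rw [Finset.mem_filter, Finset.mem_filter] at ha
        have h1 := Int.abs_sub_lt_one_of_floor_eq_floor (ha.2.trans hb.2.symm)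
        rw [← sub_div, abs_div, abs_of_pos hr0, div_lt_one hr0] at h1
        refine (dist_lift_le _ _ _ _).trans ?_
        have heq : a.1 - b.1 = (a.1 - (z + a.2 * v)) - (b.1 - (z + b.2 * v)) +
            (((a.2 : ℝ) - b.2 : ℝ) : ℂ) * v := by push_cast; ring
        have h2 : ‖(((a.2 : ℝ) - b.2 : ℝ) : ℂ) * v‖ ≤ r * 2 := by
          rw [norm_mul, Complex.norm_real, Real.norm_eq_abs]
          exact mul_le_mul h1.le hv (norm_nonneg _) hr0.le
        have h3 : ‖a.1 - b.1‖ ≤ 16 * r := by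
          rw [heq]
          refine (norm_add_le _ _).trans ?_
          have := norm_sub_le (a.1 - (z + a.2 * v)) (b.1 - (z + b.2 * v))
          linarith [ha.1.2, hb.1.2]
        linarith
      · refine mul_le_mul_of_nonneg_left ?_ hB
        rw [Real.mul_rpow (by norm_num) hr0.le]
        have h1 : (17 : ℝ) ^ α ≤ 4913 := by
          calc (17 : ℝ) ^ α ≤ 17 ^ (3 : ℝ) := Real.rpow_le_rpow_of_exponent_le (by norm_num) hα₃
            _ = 4913 := by norm_num
        have h2 := rpow_le_sq_mul_max hα₃ hL hr (by linarith : r ≤ 4 * L)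
        exact mul_le_mul h1 h2 (by positivity) (by norm_num)
  have hmax : 0 ≤ max 1 (L ^ (α - 2)) := by positivity
  rw [Finset.card_eq_sum_card_fiberwise hmaps]
  push_cast
  refine (Finset.sum_le_card_nsmul _ _ _ hfib).trans ?_
  rw [nsmul_eq_mul]
  calc T.card * (B * (4913 * (4 * max 1 (L ^ (α - 2)) * r ^ 2)))
      ≤ 360 * S.n / r * (B * (4913 * (4 * max 1 (L ^ (α - 2)) * r ^ 2))) := by gcongr
    _ = 7074720 * B * max 1 (L ^ (α - 2)) * r * S.n := by field_simp; ring

/-! ### Conclusion -/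

/-- The number of tubes in a set of dimension `α`, for all dimensions at once. -/
theorem exists_card_le_log_mul (α C : ℝ) (hα₁ : 1 ≤ α) (hα₃ : α ≤ 3) (M : ℕ) :
    ∃ K : ℝ, 0 < K ∧ ∀ (L : ℝ), 2 ≤ L → ∀ (Ω : Set R3), HasDimension C α Ω →
      ∀ (ι : Type*) (c : ι → R3) (F : ι → Set (Set R3)), IsCapDecomposition L M c →
        (∀ j, IsTubeTiling (unitNormal (c j)) L (F j)) →
        ∀ J : Finset ι, (∀ j ∈ J, j ∈ tubeDirections L F Ω) →
          (J.card : ℝ) ≤ K * Real.log L * (L ^ (α - 1) * max 1 (L ^ (α - 2))) := by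
  obtain ⟨C₀, hC₀, hmain⟩ := exists_card_tubes_le
  have hV := smallVolume_pos
  set B : ℝ := 8 * |C| / smallVolume + 1 with hB
  have hB1 : 1 ≤ B := by
    have : 0 ≤ 8 * |C| / smallVolume := by positivity
    linarith
  -- A disc of radius `1 / n ≤ 20 / L` is 50 times as large as the separation radius `2 / (5 L)`,
  -- and `40401 = (4 * 50 + 1) ^ 2`.
  set M₁ : ℝ := 40401 * (M + 1) with hM₁
  have hM0 : (0 : ℝ) ≤ M := Nat.cast_nonneg M
  have hM₁1 : 1 ≤ M₁ := by rw [hM₁]; linarith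
  set K : ℝ := 10000 * 7074720 * C₀ * M₁ * B ^ 2 with hK
  have hK0 : M₁ ≤ K := by
    have h1 : 1 ≤ C₀ * B ^ 2 := one_le_mul_of_one_le_of_one_le hC₀ (one_le_pow₀ hB1)
    calc M₁ = M₁ * 1 := (mul_one _).symm
      _ ≤ M₁ * (C₀ * B ^ 2) := by gcongr
      _ ≤ 10000 * 7074720 * (M₁ * (C₀ * B ^ 2)) := le_mul_of_one_le_left (by positivity) (by norm_num)
      _ = K := by rw [hK]; ring
  refine ⟨K, by linarith, fun L hL Ω hΩ ι c F hc hF J hJ => ?_⟩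
  have hL0 : 0 < L := by linarith
  have hlog2 : 1 / 2 ≤ Real.log L :=
    le_trans (by linarith [Real.log_two_gt_d9]) (Real.log_le_log (by norm_num) hL)
  have hmax1 : 1 ≤ max 1 (L ^ (α - 2)) := le_max_left _ _
  have hLα : 1 ≤ L ^ (α - 1) := Real.one_le_rpow (by linarith) (by linarith)
  by_cases hL6 : L < 6
  -- Tubes this short are not discretized; the number of caps is already bounded.
  · have h1 := hc.card_le hL J
    have h2 : (1 : ℝ) ≤ L ^ (α - 1) * max 1 (L ^ (α - 2)) :=
      one_le_mul_of_one_le_of_one_le hLα hmax1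
    have h3 : 529 * L ^ 2 * M ≤ M₁ * (1 / 2) := by
      have : L ^ 2 ≤ 36 := by nlinarith
      calc 529 * L ^ 2 * M ≤ 529 * 36 * M := by gcongr
        _ ≤ M₁ * (1 / 2) := by rw [hM₁]; linarith
    calc (J.card : ℝ) ≤ M₁ * (1 / 2) := h1.trans h3
      _ ≤ K * Real.log L := mul_le_mul hK0 hlog2 (by norm_num) (by linarith)
      _ ≤ _ := le_mul_of_one_le_right (mul_nonneg (by linarith) (by linarith)) h2
  push Not at hL6
  obtain ⟨S, hSJ, hSω, hn, hn', hball, hsep⟩ := exists_tubeConfig hL6 Ω hc hF J hJ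
  have hnpos := S.n_pos
  have hdim : ∀ P ⊆ S.points, ∀ (x : R3) (R : ℝ), 1 ≤ R →
      (∀ a ∈ P, dist (lift a.1 a.2) x ≤ R) → (P.card : ℝ) ≤ B * R ^ α := by
    intro P hP x R hR hx
    refine (hΩ.card_le hα₃ P (fun a => lift a.1 a.2) (fun a ha => (hball a (hP ha)).1)
      (fun a ha b hb => hsep a (hP ha) b (hP hb)) hR hx).trans ?_
    have : 0 ≤ R ^ α := Real.rpow_nonneg (by linarith) _
    gcongr
    linarith
  have hfat := S.fatBound_of_dimension (L := L) (α := α) (B := B) (by linarith) hα₃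
    (by linarith) hn hn' hdim (fun a ha => by
      have h1 := (hball a ha).2
      rw [dist_zero_right] at h1
      refine le_trans ?_ h1
      refine abs_le_of_sq_le_sq ?_ (norm_nonneg _)
      rw [norm_sq_r3]
      simp only [lift, PiLp.toLp_apply, Matrix.cons_val]
      nlinarith [sq_nonneg a.1.re, sq_nonneg a.1.im])
  have hdir : S.DirSep M₁ := by
    intro z
    refine (hc.card_le_of_subset_disc hL0 _ z 50 fun j hj => ?_).trans ?_
    · rw [← hSω]
      refine (Finset.mem_filter.mp hj).2.trans ?_
      rw [div_le_iff₀ hnpos]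
      push_cast
      rw [show 50 * (2 / (5 * L)) * S.n = 20 * S.n / L by field_simp; norm_num,
        le_div_iff₀ hL0]
      linarith
    · rw [hM₁]; push_cast; linarith
  have hD1 : 1 ≤ 7074720 * B * max 1 (L ^ (α - 2)) :=
    one_le_mul_of_one_le_of_one_le (by linarith) hmax1
  have hcount := hmain S hdir hM₁1 hfat hD1
  rw [hSJ] at hcount
  have hQ : (S.points.card : ℝ) ≤ B * (125 * L ^ α) := by
    refine (hdim S.points subset_rfl 0 (5 * L) (by linarith) fun a ha => (hball a ha).2).trans ?_
    rw [Real.mul_rpow (by norm_num) hL0.le]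
    have h1 : (5 : ℝ) ^ α ≤ 125 := by
      calc (5 : ℝ) ^ α ≤ 5 ^ (3 : ℝ) := Real.rpow_le_rpow_of_exponent_le (by norm_num) hα₃
        _ = 125 := by norm_num
    gcongr
  have he : (S.e : ℝ) + 1 ≤ 4 * Real.log L := by
    have h1 : Real.log S.n ≤ Real.log L := Real.log_le_log hnpos hn
    have h2 : Real.log S.n = S.e * Real.log 2 := by unfold TubeConfig.n; rw [Real.log_pow]
    have h3 : (S.e : ℝ) * (1 / 2) ≤ S.e * Real.log 2 := by
      have := Real.log_two_gt_d9
      gcongr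
      linarith
    linarith
  have hpow : L ^ α = L * L ^ (α - 1) := by
    conv_rhs => rw [← Real.rpow_one L, ← Real.rpow_mul hL0.le, ← Real.rpow_add hL0]
    congr 1; ring
  refine le_of_mul_le_mul_right ?_ (show 0 < L / 20 by positivity)
  calc (J.card : ℝ) * (L / 20) ≤ J.card * S.n := by gcongr; linarith
    _ ≤ C₀ * (M₁ * (7074720 * B * max 1 (L ^ (α - 2))) * (S.e + 1) * S.points.card) := hcount
    _ ≤ C₀ * (M₁ * (7074720 * B * max 1 (L ^ (α - 2))) * (4 * Real.log L) *
          (B * (125 * (L * L ^ (α - 1))))) := by rw [← hpow]; gcongr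
    _ = K * Real.log L * (L ^ (α - 1) * max 1 (L ^ (α - 2))) * (L / 20) := by
        rw [hK]; ring

end TubeGeometry

theorem theorem4p1 (α C : ℝ) (hα₁ : 1 ≤ α) (hα₃ : α ≤ 3) (M : ℕ) :
    ∃ K : ℝ, 0 < K ∧
      ∀ (L : ℝ), 2 ≤ L →
      ∀ (Ω : Set R3), HasDimension C α Ω →
      ∀ (ι : Type*) (c : ι → R3) (F : ι → Set (Set R3)),
        IsCapDecomposition L M c →
        (∀ j, IsTubeTiling (unitNormal (c j)) L (F j)) →
        (tubeDirections L F Ω).Finite ∧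
        (α ≤ 2 →
          ((tubeDirections L F Ω).ncard : ℝ) ≤ K * Real.log L * L ^ (α - 1)) ∧
        (2 ≤ α →
          ((tubeDirections L F Ω).ncard : ℝ) ≤ K * Real.log L * L ^ (2 * α - 3)) := by
  obtain ⟨K, hK, hmain⟩ := exists_card_le_log_mul α C hα₁ hα₃ M
  refine ⟨K, hK, fun L hL Ω hΩ ι c F hc hF => ?_⟩
  have hfin : (tubeDirections L F Ω).Finite := by
    have := hc.finite hL
    exact Set.toFinite _
  have hcard := hmain L hL Ω hΩ ι c F hc hF hfin.toFinset fun j hj => hfin.mem_toFinset.mp hj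
  rw [← Set.ncard_eq_toFinset_card _ hfin] at hcard
  refine ⟨hfin, fun hα => ?_, fun hα => ?_⟩
  · rwa [max_eq_left (Real.rpow_le_one_of_one_le_of_nonpos (by linarith) (by linarith)),
      mul_one] at hcard
  · rwa [max_eq_right (Real.one_le_rpow (by linarith) (by linarith)),
      ← Real.rpow_add (by linarith), show α - 1 + (α - 2) = 2 * α - 3 by ring] at hcard
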